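/- For integers $n,m\geq 2$, let the Higman--Thompson group $T_{n,m}$ be the group, under composition, of all orientation-preserving piecewise affine homeomorphisms $h$ of the circle $\mathbb{R}/m\mathbb{Z}$ that have finitely many breakpoints, all lying in the image of $\mathbb{Z}[1/n]$, whose slopes are all integral powers of $n$, and that map the image of $\mathbb{Z}[1/n]$ in $\mathbb{R}/m\mathbb{Z}$ onto itself. Let $n,m,r,s\geq 2$ be integers. If the groups $T_{n,m}$ and $T_{r,s}$ are isomorphic, then $n=r$. -/

import Mathlib

open Filter Topology

/-- A point of the circle `ℝ/mℤ` is `n`-adic if it is the class of some `a / n ^ k`, i.e. of an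
element of `ℤ[1/n]`. -/
def IsNAdicPoint (n m : ℕ) (x : AddCircle (m : ℝ)) : Prop :=
  ∃ (a : ℤ) (k : ℕ), x = (((a : ℝ) / (n : ℝ) ^ k : ℝ) : AddCircle (m : ℝ))

/-- Near `x`, the self-map `h` of `ℝ/mℤ` is affine with slope an integral power of `n`
(in particular it preserves the orientation there). -/
def IsLocallyAffineAt (n m : ℕ) (h : AddCircle (m : ℝ) → AddCircle (m : ℝ))
    (x : AddCircle (m : ℝ)) : Prop :=
  ∃ k : ℤ, ∀ᶠ t : ℝ in 𝓝 0,
    h (x + (t : AddCircle (m : ℝ))) = h x + (((n : ℝ) ^ k * t : ℝ) : AddCircle (m : ℝ))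

theorem IsLocallyAffineAt.comp {n m : ℕ} (g h : AddCircle (m : ℝ) ≃ₜ AddCircle (m : ℝ))
    {x : AddCircle (m : ℝ)} (hg : IsLocallyAffineAt n m g (h x))
    (hh : IsLocallyAffineAt n m h x) : IsLocallyAffineAt n m (g ∘ h) x := by
  obtain ⟨k, hk⟩ := hh
  obtain ⟨l, hl⟩ := hg
  have h0 : Tendsto (fun t : ℝ => (n : ℝ) ^ k * t) (𝓝 0) (𝓝 0) := by
    have : Continuous fun t : ℝ => (n : ℝ) ^ k * t := by fun_prop
    simpa using this.tendsto 0
  have h1 := h0.eventually hl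
  by_cases hkn : n = 0 ∧ k ≠ 0
  · obtain ⟨rfl, hk0⟩ := hkn
    refine ⟨1, ?_⟩
    filter_upwards [hk] with t ht
    simp [ht, zero_zpow k hk0]
  · refine ⟨l + k, ?_⟩
    have e : (n : ℝ) ^ (l + k) = (n : ℝ) ^ l * (n : ℝ) ^ k := by
      by_cases hn : n = 0
      · have : k = 0 := by
          by_contra hk0
          exact hkn ⟨hn, hk0⟩
        simp [this]
      · exact zpow_add₀ (by exact_mod_cast hn) l k
    filter_upwards [hk, h1] with t ht ht1
    simp only [Function.comp_apply]
    rw [ht, ht1, e, mul_assoc]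

theorem IsLocallyAffineAt.symm {n m : ℕ} (h : AddCircle (m : ℝ) ≃ₜ AddCircle (m : ℝ))
    {x : AddCircle (m : ℝ)} (hh : IsLocallyAffineAt n m h x) :
    IsLocallyAffineAt n m h.symm (h x) := by
  obtain ⟨k, hk⟩ := hh
  refine ⟨-k, ?_⟩
  by_cases hkn : n = 0 ∧ k ≠ 0
  · obtain ⟨rfl, hk0⟩ := hkn
    filter_upwards [hk] with t ht
    have h2 : x + (t : AddCircle (m : ℝ)) = x := by
      apply h.injective
      rw [ht]
      simp [zero_zpow k hk0]
    have h3 : (t : AddCircle (m : ℝ)) = 0 := by simpa using h2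
    simp [h3, zero_zpow k hk0]
  · have h0 : Tendsto (fun t : ℝ => (n : ℝ) ^ (-k) * t) (𝓝 0) (𝓝 0) := by
      have : Continuous fun t : ℝ => (n : ℝ) ^ (-k) * t := by fun_prop
      simpa using this.tendsto 0
    have e : (n : ℝ) ^ k * (n : ℝ) ^ (-k) = 1 := by
      by_cases hn : n = 0
      · have : k = 0 := by
          by_contra hk0
          exact hkn ⟨hn, hk0⟩
        simp [this]
      · rw [zpow_neg]
        exact mul_inv_cancel₀ (zpow_ne_zero _ (by exact_mod_cast hn))
    filter_upwards [h0.eventually hk] with t ht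
    rw [← mul_assoc, e, one_mul] at ht
    rw [← ht, h.symm_apply_apply, h.symm_apply_apply]

/-- The Higman–Thompson group `T_{n,m}`: the homeomorphisms of the circle `ℝ/mℤ` that are
piecewise affine, with finitely many breakpoints, all of them `n`-adic, with all slopes integral
powers of `n` (so orientation-preserving), and that map the set of `n`-adic points onto itself.
The group law is composition. -/
def HigmanThompsonT (n m : ℕ) : Subgroup (AddCircle (m : ℝ) ≃ₜ AddCircle (m : ℝ)) where
  carrier := {h |
    (∃ B : Set (AddCircle (m : ℝ)), B.Finite ∧ (∀ x ∈ B, IsNAdicPoint n m x) ∧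
      ∀ x, x ∉ B → IsLocallyAffineAt n m h x) ∧
    ∀ x, IsNAdicPoint n m (h x) ↔ IsNAdicPoint n m x}
  one_mem' := by
    refine ⟨⟨∅, Set.finite_empty, by simp, fun x _ => ⟨0, ?_⟩⟩, fun x => Iff.rfl⟩
    exact Eventually.of_forall fun t => by simp
  mul_mem' := by
    rintro g h ⟨⟨B, hB, hBn, hBa⟩, hg⟩ ⟨⟨C, hC, hCn, hCa⟩, hh⟩
    refine ⟨⟨C ∪ h ⁻¹' B, hC.union (hB.preimage h.injective.injOn), ?_, ?_⟩, ?_⟩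
    · rintro x (hx | hx)
      · exact hCn x hx
      · exact (hh x).1 (hBn _ hx)
    · intro x hx
      exact IsLocallyAffineAt.comp g h (hBa _ fun hx' => hx (Or.inr hx'))
        (hCa x fun hx' => hx (Or.inl hx'))
    · intro x
      exact (hg (h x)).trans (hh x)
  inv_mem' := by
    rintro h ⟨⟨B, hB, hBn, hBa⟩, hh⟩
    refine ⟨⟨h '' B, hB.image h, ?_, ?_⟩, ?_⟩
    · rintro _ ⟨x, hx, rfl⟩
      exact (hh x).2 (hBn x hx)
    · intro y hy
      obtain ⟨x, rfl⟩ := h.surjective y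
      exact IsLocallyAffineAt.symm h (hBa x fun hx => hy ⟨x, hx, rfl⟩)
    · intro y
      have := hh (h.symm y)
      rw [h.apply_symm_apply] at this
      exact this.symm

/-!
The number `n - 1` is read off from the abstract group `HigmanThompsonT n m` as the number of
conjugacy classes of a family of subgroups that is defined in purely group-theoretic terms.

*Supports are algebraic.* The group is locally moving: every nonempty open subset of the circle
supports an element of infinite order. For such groups the relation `AlgDisjoint`, in the spirit of
Rubin's reconstruction theorem, recognizes disjointness of supports up to a twelfth power, and
`suppSubgroup f`, the centralizer of all `g ^ 12` with `f` algebraically disjoint from `g`, is the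
group of the elements supported in the closure of the support of `f` (`mem_suppSubgroup_iff`).

*Arcs are algebraic.* The closure of a support is the circle, or empty, or a finite union of closed
arcs with `n`-adic endpoints. It is a single arc exactly when its subgroup is proper and nontrivial
and has no smaller nontrivial normal subgroup `suppSubgroup f'` (`IsArcSubgroup`): a component of
the support gives such a normal subgroup (`exists_arc_of_support`, `exists_eq_arcFixing`), and
conversely the elements supported in an arc move its `n`-adic points so freely that a closed set
invariant under them and with interior is the whole arc (`isArcSubgroup_arcFixing`).

*Counting arcs.* An affine map of slope `n ^ k` preserves lengths in `ℤ[1/n]` modulo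
`(n - 1) ℤ[1/n]`; hence so does every element of the group (`IsLift.lt_and_sub_mem`). Conversely two
arcs of congruent lengths are exchanged by the group (`exists_PLOn`, `exists_map_arc`). As
`ℤ[1/n] / (n - 1) ℤ[1/n]` is cyclic of order `n - 1`, there are `n - 1` conjugacy classes of arc
subgroups (`card_quot_arcConj`), and an isomorphism preserves this number.
-/

open scoped commutatorElement

/-! ### Algebraic disjointness and reconstruction of supports -/

/-- `f` is algebraically disjoint from `g`: whenever `h` fails to commute with `f`, some iterated
commutator `⁅f₁, ⁅f₂, h⁆⁆` with `f₁`, `f₂` in the centralizer of `g` is a nontrivial element of that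
centralizer. -/
def AlgDisjoint {G : Type*} [Group G] (f g : G) : Prop :=
  ∀ h, ¬ Commute f h → ∃ f₁ f₂, Commute f₁ g ∧ Commute f₂ g ∧ ⁅f₁, ⁅f₂, h⁆⁆ ≠ 1 ∧
    Commute ⁅f₁, ⁅f₂, h⁆⁆ g

/-- The centralizer of the twelfth powers of the elements from which `f` is algebraically disjoint.
In a locally moving group of homeomorphisms this is the subgroup of the elements supported in the
closure of the support of `f`, see `mem_suppSubgroup_iff`. -/
def suppSubgroup {G : Type*} [Group G] (f : G) : Subgroup G :=
  Subgroup.centralizer {x | ∃ g, AlgDisjoint f g ∧ x = g ^ 12}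

/-- A proper nontrivial subgroup of the form `suppSubgroup f` none of whose nontrivial proper
normal subgroups is of this form. In `HigmanThompsonT n m` these are the subgroups of the elements
supported in a given `n`-adic arc. -/
def IsArcSubgroup {G : Type*} [Group G] (A : Subgroup G) : Prop :=
  A ≠ ⊥ ∧ A ≠ ⊤ ∧ (∃ f, A = suppSubgroup f) ∧
    ∀ f, suppSubgroup f ≤ A → suppSubgroup f ≠ ⊥ →
      (∀ a ∈ A, ∀ x ∈ suppSubgroup f, a * x * a⁻¹ ∈ suppSubgroup f) → suppSubgroup f = A

/-- Conjugacy of arc subgroups. -/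
def ArcConj (G : Type*) [Group G] (A B : {A : Subgroup G // IsArcSubgroup A}) : Prop :=
  ∃ g : G, A.1.map (MulAut.conj g).toMonoidHom = B.1

theorem AlgDisjoint.map {G H : Type*} [Group G] [Group H] (φ : G ≃* H) {f g : G}
    (h : AlgDisjoint f g) : AlgDisjoint (φ f) (φ g) := by
  intro k hk
  obtain ⟨k, rfl⟩ := φ.surjective k
  obtain ⟨f₁, f₂, h1, h2, h3, h4⟩ := h k fun hc => hk (hc.map φ)
  refine ⟨φ f₁, φ f₂, h1.map φ, h2.map φ, ?_, ?_⟩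
  · rw [← map_commutatorElement, ← map_commutatorElement]
    exact fun h => h3 ((map_eq_one_iff φ φ.injective).1 h)
  · rw [← map_commutatorElement, ← map_commutatorElement]
    exact h4.map φ

theorem algDisjoint_map_iff {G H : Type*} [Group G] [Group H] (φ : G ≃* H) {f g : G} :
    AlgDisjoint (φ f) (φ g) ↔ AlgDisjoint f g :=
  ⟨fun h => by simpa using h.map φ.symm, fun h => h.map φ⟩

theorem map_mem_suppSubgroup_iff {G H : Type*} [Group G] [Group H] (φ : G ≃* H) {f k : G} :
    φ k ∈ suppSubgroup (φ f) ↔ k ∈ suppSubgroup f := by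
  simp only [suppSubgroup, Subgroup.mem_centralizer_iff, Set.mem_ofPred_eq]
  constructor
  · rintro h _ ⟨g, hg, rfl⟩
    have := h _ ⟨φ g, hg.map φ, rfl⟩
    rw [← map_pow, ← map_mul, ← map_mul] at this
    exact φ.injective this
  · rintro h _ ⟨g, hg, rfl⟩
    obtain ⟨g, rfl⟩ := φ.surjective g
    rw [← map_pow, ← map_mul, ← map_mul, h _ ⟨g, (algDisjoint_map_iff φ).1 hg, rfl⟩]

theorem map_suppSubgroup {G H : Type*} [Group G] [Group H] (φ : G ≃* H) (f : G) :
    (suppSubgroup f).map φ.toMonoidHom = suppSubgroup (φ f) := by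
  ext k
  obtain ⟨k, rfl⟩ := φ.surjective k
  rw [map_mem_suppSubgroup_iff]
  constructor
  · rintro ⟨x, hx, hxk⟩
    rwa [← φ.injective hxk]
  · exact fun h => ⟨k, h, rfl⟩

theorem IsArcSubgroup.map {G H : Type*} [Group G] [Group H] (φ : G ≃* H) {A : Subgroup G}
    (hA : IsArcSubgroup A) : IsArcSubgroup (A.map φ.toMonoidHom) := by
  have hinj : Function.Injective (Subgroup.map φ.toMonoidHom) :=
    Subgroup.map_injective φ.injective
  have hbot : (⊥ : Subgroup G).map φ.toMonoidHom = ⊥ := Subgroup.map_bot _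
  have htop : (⊤ : Subgroup G).map φ.toMonoidHom = ⊤ :=
    Subgroup.map_top_of_surjective _ φ.surjective
  obtain ⟨h1, h2, ⟨f, hf⟩, h3⟩ := hA
  refine ⟨fun h => h1 (hinj (h.trans hbot.symm)), fun h => h2 (hinj (h.trans htop.symm)),
    ⟨φ f, by rw [hf, map_suppSubgroup]⟩, ?_⟩
  intro f' hle hne hnorm
  obtain ⟨f', rfl⟩ := φ.surjective f'
  rw [← map_suppSubgroup] at hle hne ⊢
  congr 1
  apply h3 f'
  · exact (Subgroup.map_le_map_iff_of_injective φ.injective).1 hle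
  · rintro h
    exact hne (by rw [h, hbot])
  · intro a ha x hx
    have := hnorm (φ a) ⟨a, ha, rfl⟩ (φ x) ((map_mem_suppSubgroup_iff φ).2 hx)
    rwa [← map_inv, ← map_mul, ← map_mul, map_mem_suppSubgroup_iff] at this

theorem ArcConj.map {G H : Type*} [Group G] [Group H] (φ : G ≃* H)
    {A B : {A : Subgroup G // IsArcSubgroup A}} (h : ArcConj G A B) :
    ArcConj H ⟨A.1.map φ.toMonoidHom, A.2.map φ⟩ ⟨B.1.map φ.toMonoidHom, B.2.map φ⟩ := by
  obtain ⟨g, hg⟩ := h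
  refine ⟨φ g, ?_⟩
  simp only [← hg, Subgroup.map_map]
  congr 1
  ext x
  simp

theorem map_map_symm {G H : Type*} [Group G] [Group H] (φ : G ≃* H) (A : Subgroup G) :
    (A.map φ.toMonoidHom).map φ.symm.toMonoidHom = A := by
  rw [Subgroup.map_map]
  convert Subgroup.map_id A
  ext x
  simp

/-- The number of conjugacy classes of arc subgroups is an isomorphism invariant. -/
theorem card_quot_arcConj_eq {G H : Type*} [Group G] [Group H] (φ : G ≃* H) :
    Nat.card (Quot (ArcConj G)) = Nat.card (Quot (ArcConj H)) := by
  refine Nat.card_congr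
    { toFun := Quot.map (fun A => ⟨A.1.map φ.toMonoidHom, A.2.map φ⟩) fun _ _ h => h.map φ
      invFun := Quot.map (fun A => ⟨A.1.map φ.symm.toMonoidHom, A.2.map φ.symm⟩)
        fun _ _ h => h.map φ.symm
      left_inv := ?_
      right_inv := ?_ }
  · rintro ⟨A⟩
    exact congrArg (Quot.mk _) (Subtype.ext (map_map_symm φ A.1))
  · rintro ⟨A⟩
    exact congrArg (Quot.mk _) (Subtype.ext (map_map_symm φ.symm A.1))

section Homeo

variable {X : Type*} [TopologicalSpace X]

/-- The points moved by `f`, an open set when the space is Hausdorff. -/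
def movedSet (f : X ≃ₜ X) : Set X := {x | f x ≠ x}

theorem isOpen_movedSet [T2Space X] (f : X ≃ₜ X) : IsOpen (movedSet f) :=
  isOpen_ne_fun f.continuous continuous_id

/-- A group of homeomorphisms is locally moving (in the strong form needed here) if every nonempty
open set supports an element whose twelfth power is nontrivial. -/
def LocallyMoving (G : Subgroup (X ≃ₜ X)) : Prop :=
  ∀ V : Set X, IsOpen V → V.Nonempty → ∃ g : G, (∀ x, x ∉ V → g.1 x = x) ∧ g ^ 12 ≠ 1

variable {G : Subgroup (X ≃ₜ X)}

theorem commute_iff_apply {f g : G} : Commute f g ↔ ∀ x, f.1 (g.1 x) = g.1 (f.1 x) := by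
  constructor
  · intro h x
    have : (f * g).1 x = (g * f).1 x := by rw [h.eq]
    exact this
  · intro h
    exact Subtype.ext (Homeomorph.ext h)

theorem commute_of_disjoint {f g : G} {A B : Set X} (hf : ∀ x, x ∉ A → f.1 x = x)
    (hg : ∀ x, x ∉ B → g.1 x = x) (hAB : Disjoint A B) : Commute f g := by
  have maps : ∀ {h : G} {C : Set X}, (∀ x, x ∉ C → h.1 x = x) → ∀ x ∈ C, h.1 x ∈ C := by
    intro h C hh x hx
    by_contra hx'
    exact hx' (by rwa [h.1.injective (hh _ hx')])
  rw [commute_iff_apply]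
  intro x
  by_cases hA : x ∈ A
  · rw [hg x (Set.disjoint_left.1 hAB hA), hg _ (Set.disjoint_left.1 hAB (maps hf x hA))]
  · rw [hf x hA]
    by_cases hB : x ∈ B
    · exact hf _ (Set.disjoint_right.1 hAB (maps hg x hB))
    · rw [hg x hB, hf x hA]

theorem exists_ne_of_ne_one {f : G} (hf : f ≠ 1) : ∃ x, f.1 x ≠ x := by
  by_contra! h
  exact hf (Subtype.ext (Homeomorph.ext h))

theorem exists_isOpen_disjoint_image [T2Space X] (f : X ≃ₜ X) {x : X} (hx : f x ≠ x) :
    ∃ V : Set X, IsOpen V ∧ x ∈ V ∧ ∀ y ∈ V, f y ∉ V := by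
  obtain ⟨U, W, hU, hW, h1, h2, h3⟩ := t2_separation hx
  refine ⟨W ∩ f ⁻¹' U, hW.inter (hU.preimage f.continuous), ⟨h2, h1⟩, ?_⟩
  rintro y ⟨-, hy⟩ ⟨hy', -⟩
  exact Set.disjoint_left.1 h3 hy hy'

theorem pow_apply_eq {f : G} {x : X} (hx : f.1 x = x) (i : ℕ) : (f ^ i).1 x = x := by
  induction i with
  | zero => rfl
  | succ i ih =>
    rw [pow_succ]
    change (f ^ i).1 (f.1 x) = x
    rw [hx, ih]

theorem inv_apply_eq {f : G} {x : X} (hx : f.1 x = x) : (f⁻¹).1 x = x := by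
  conv_lhs => rw [← hx]
  exact f.1.symm_apply_apply x

/-- Elements with disjoint supports are algebraically disjoint. -/
theorem algDisjoint_of_disjoint [T2Space X] (hG : LocallyMoving G) {f g : G}
    (h : ∀ x, f.1 x ≠ x → g.1 x = x) : AlgDisjoint f g := by
  intro k hk
  obtain ⟨y, hfy, hky⟩ : ∃ y, f.1 y ≠ y ∧ k.1 y ≠ y := by
    by_contra! hc
    refine hk (commute_of_disjoint (A := movedSet f.1) (B := (movedSet f.1)ᶜ) ?_ ?_
      disjoint_compl_right)
    · exact fun x hx => not_not.1 hx
    · exact fun x hx => hc x (not_not.1 hx)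
  obtain ⟨V, hV, hyV, hVk⟩ := exists_isOpen_disjoint_image k.1 hky
  obtain ⟨f₂, hf₂, hf₂n⟩ := hG (V ∩ movedSet f.1) (hV.inter (isOpen_movedSet f.1)) ⟨y, hyV, hfy⟩
  obtain ⟨z, hz⟩ := exists_ne_of_ne_one (f := f₂) fun h => hf₂n (by simp [h])
  have hzV : z ∈ V ∩ movedSet f.1 := by
    by_contra hzV
    exact hz (hf₂ z hzV)
  obtain ⟨W, hW, hzW, hWf⟩ := exists_isOpen_disjoint_image f₂.1 hz
  obtain ⟨f₁, hf₁, hf₁n⟩ := hG (W ∩ (V ∩ movedSet f.1))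
    (hW.inter (hV.inter (isOpen_movedSet f.1))) ⟨z, hzW, hzV⟩
  obtain ⟨w, hw⟩ := exists_ne_of_ne_one (f := f₁) fun h => hf₁n (by simp [h])
  have hwW : w ∈ W ∩ (V ∩ movedSet f.1) := by
    by_contra hwV
    exact hw (hf₁ w hwV)
  have hf₁' : ∀ x, x ∉ V ∩ movedSet f.1 → f₁.1 x = x := fun x hx => hf₁ x fun hx' => hx hx'.2
  have hne : ¬ Commute f₁ f₂ := by
    intro hc
    have := commute_iff_apply.1 hc w
    rw [hf₁ (f₂.1 w) fun h' => hWf w hwW.1 h'.1] at this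
    exact hw (f₂.1.injective this).symm
  have hg : ∀ x, x ∉ (movedSet f.1)ᶜ → g.1 x = x := fun x hx => h x (not_not.1 hx)
  have c1 : Commute f₁ g := commute_of_disjoint hf₁' hg
    (Set.disjoint_left.2 fun x hx hx' => hx' hx.2)
  have c2 : Commute f₂ g := commute_of_disjoint hf₂ hg
    (Set.disjoint_left.2 fun x hx hx' => hx' hx.2)
  -- The conjugate `k f₂⁻¹ k⁻¹` is supported in `k V`, away from `V`, so that it commutes with `f₁`
  -- and disappears from the iterated commutator.
  have c3 : Commute f₁ (k * f₂⁻¹ * k⁻¹) := by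
    refine commute_of_disjoint hf₁' (B := k.1 '' V) ?_ ?_
    · intro x hx
      have h1 : (k⁻¹).1 x ∉ V := fun h' => hx ⟨_, h', k.1.apply_symm_apply x⟩
      change k.1 ((f₂⁻¹).1 ((k⁻¹).1 x)) = x
      rw [inv_apply_eq (hf₂ _ fun h' => h1 h'.1)]
      exact k.1.apply_symm_apply x
    · rw [Set.disjoint_left]
      rintro _ ⟨hx, -⟩ ⟨y, hy, rfl⟩
      exact hVk y hy hx
  have e : ⁅f₁, ⁅f₂, k⁆⁆ = ⁅f₁, f₂⁆ := by
    have e1 : ⁅f₂, k⁆ = f₂ * (k * f₂⁻¹ * k⁻¹) := by rw [commutatorElement_def]; group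
    have e2 : (k * f₂⁻¹ * k⁻¹) * f₁⁻¹ = f₁⁻¹ * (k * f₂⁻¹ * k⁻¹) := (c3.inv_left).symm.eq
    rw [e1, commutatorElement_def, commutatorElement_def, mul_inv_rev]
    generalize k * f₂⁻¹ * k⁻¹ = c at e2
    calc f₁ * (f₂ * c) * f₁⁻¹ * (c⁻¹ * f₂⁻¹) = f₁ * f₂ * (c * f₁⁻¹) * c⁻¹ * f₂⁻¹ := by group
      _ = f₁ * f₂ * f₁⁻¹ * f₂⁻¹ := by rw [e2]; group
  refine ⟨f₁, f₂, c1, c2, ?_, ?_⟩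
  · rw [e]
    exact fun h => hne (commutatorElement_eq_one_iff_commute.1 h)
  · rw [e, commutatorElement_def]
    exact ((c1.mul_left c2).mul_left c1.inv_left).mul_left c2.inv_left

/-- If `f` is algebraically disjoint from `g`, then `g ^ 12` is the identity on the support of `f`.
Otherwise a small set `V` in the support of `f` has five disjoint translates under the powers of
`g`, while the iterated commutator provided by algebraic disjointness has a `g`-invariant support
covered by four translates of `V` under elements commuting with `g`. -/
theorem AlgDisjoint.pow_apply_eq [T2Space X] (hG : LocallyMoving G) {f g : G}
    (h : AlgDisjoint f g) {x : X} (hx : f.1 x ≠ x) : (g ^ 12).1 x = x := by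
  by_contra hgx
  have hd : ∀ d : ℕ, d ∣ 12 → (g ^ d).1 x ≠ x := by
    rintro d ⟨e, he⟩ hd
    rw [he, pow_mul] at hgx
    exact hgx (_root_.pow_apply_eq hd e)
  obtain ⟨V0, hV0, hxV0, hfV⟩ := exists_isOpen_disjoint_image f.1 hx
  obtain ⟨V1, hV1, hxV1, hgV1⟩ := exists_isOpen_disjoint_image _ (hd 1 (by norm_num))
  obtain ⟨V2, hV2, hxV2, hgV2⟩ := exists_isOpen_disjoint_image _ (hd 2 (by norm_num))
  obtain ⟨V3, hV3, hxV3, hgV3⟩ := exists_isOpen_disjoint_image _ (hd 3 (by norm_num))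
  obtain ⟨V4, hV4, hxV4, hgV4⟩ := exists_isOpen_disjoint_image _ (hd 4 (by norm_num))
  obtain ⟨V, hVdef⟩ : ∃ V, V = V0 ∩ (V1 ∩ (V2 ∩ (V3 ∩ V4))) := ⟨_, rfl⟩
  have hV : IsOpen V := by
    rw [hVdef]
    exact hV0.inter (hV1.inter (hV2.inter (hV3.inter hV4)))
  have hxV : x ∈ V := by
    rw [hVdef]
    exact ⟨hxV0, hxV1, hxV2, hxV3, hxV4⟩
  have hgV : ∀ d, 1 ≤ d → d ≤ 4 → ∀ y ∈ V, (g ^ d).1 y ∉ V := by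
    rw [hVdef]
    rintro d h1 h4 y ⟨y0, y1, y2, y3, y4⟩ ⟨z0, z1, z2, z3, z4⟩
    interval_cases d
    · exact hgV1 y y1 z1
    · exact hgV2 y y2 z2
    · exact hgV3 y y3 z3
    · exact hgV4 y y4 z4
  obtain ⟨k, hk, hkn⟩ := hG V hV ⟨x, hxV⟩
  obtain ⟨w, hw⟩ := exists_ne_of_ne_one (f := k) fun h => hkn (by simp [h])
  have hwV : w ∈ V := by
    by_contra hwV
    exact hw (hk w hwV)
  have hne : ¬ Commute f k := by
    intro hc
    have := commute_iff_apply.1 hc w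
    rw [hk (f.1 w) fun h' => hfV w (hVdef ▸ hwV).1 (hVdef ▸ h').1] at this
    exact hw (f.1.injective this)
  obtain ⟨f₁, f₂, c1, c2, hc, cg⟩ := h k hne
  obtain ⟨y, hy⟩ := exists_ne_of_ne_one hc
  have hsupp : ∀ z, ⁅f₁, ⁅f₂, k⁆⁆.1 z ≠ z → ∃ i : Fin 4,
      ((![1, f₂, f₁, f₁ * f₂] i)⁻¹).1 z ∈ V := by
    intro z hz
    by_contra! hc
    have k0 : k.1 z = z := hk _ (by simpa using hc 0)
    have k1 : (k⁻¹).1 ((f₂⁻¹).1 z) = (f₂⁻¹).1 z := inv_apply_eq (hk _ (by simpa using hc 1))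
    have k2 : (k⁻¹).1 ((f₁⁻¹).1 z) = (f₁⁻¹).1 z := inv_apply_eq (hk _ (by simpa using hc 2))
    have k3 : k.1 ((f₂⁻¹).1 ((f₁⁻¹).1 z)) = (f₂⁻¹).1 ((f₁⁻¹).1 z) := by
      apply hk
      have := hc 3
      simpa [mul_inv_rev] using this
    apply hz
    have e : ⁅f₁, ⁅f₂, k⁆⁆ = f₁ * (f₂ * (k * (f₂⁻¹ * (k⁻¹ * (f₁⁻¹ *
        (k * (f₂ * (k⁻¹ * f₂⁻¹)))))))) := by
      rw [commutatorElement_def, commutatorElement_def]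
      group
    rw [e]
    change f₁.1 (f₂.1 (k.1 ((f₂⁻¹).1 ((k⁻¹).1 ((f₁⁻¹).1
      (k.1 (f₂.1 ((k⁻¹).1 ((f₂⁻¹).1 z))))))))) = z
    have s2 : ∀ u, f₂.1 ((f₂⁻¹).1 u) = u := fun u => f₂.1.apply_symm_apply u
    have s1 : ∀ u, f₁.1 ((f₁⁻¹).1 u) = u := fun u => f₁.1.apply_symm_apply u
    rw [k1, s2, k0, k2, k3, s2, s1]
  have hmoved : ∀ i : Fin 5, ⁅f₁, ⁅f₂, k⁆⁆.1 ((g ^ (i : ℕ)).1 y) ≠ (g ^ (i : ℕ)).1 y := by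
    intro i hi
    rw [commute_iff_apply.1 (cg.pow_right _) y] at hi
    exact hy ((g ^ (i : ℕ)).1.injective hi)
  choose c hc using fun i => hsupp _ (hmoved i)
  have hcomm : ∀ i : Fin 4, Commute (![1, f₂, f₁, f₁ * f₂] i) g := by
    intro i
    fin_cases i
    · exact Commute.one_left g
    · exact c2
    · exact c1
    · exact c1.mul_left c2
  have final : ∀ i j : Fin 5, i < j → c i ≠ c j := by
    intro i j hij hcij
    have hi := hc i
    have hj := hc j
    rw [← hcij] at hj
    apply hgV (j - i : ℕ) (by omega) (by omega) _ hi
    rw [← commute_iff_apply.1 ((hcomm (c i)).inv_left.pow_right _)]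
    have : (g ^ (j - i : ℕ)).1 ((g ^ (i : ℕ)).1 y) = (g ^ (j : ℕ)).1 y := by
      rw [← Homeomorph.mul_apply, ← Subgroup.coe_mul, ← pow_add]
      congr 3
      omega
    rwa [this]
  obtain ⟨i, j, hij, hcij⟩ := Fintype.exists_ne_map_eq_of_card_lt c (by simp)
  rcases lt_or_gt_of_ne hij with h' | h'
  · exact final i j h' hcij
  · exact final j i h' hcij.symm

theorem mem_suppSubgroup_iff [T2Space X] (hG : LocallyMoving G) {f k : G} :
    k ∈ suppSubgroup f ↔ ∀ x, x ∉ closure (movedSet f.1) → k.1 x = x := by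
  rw [suppSubgroup, Subgroup.mem_centralizer_iff]
  constructor
  · intro h x hx
    by_contra hkx
    obtain ⟨V, hV, hxV, hkV⟩ := exists_isOpen_disjoint_image k.1 hkx
    obtain ⟨g, hg, hgn⟩ := hG (V ∩ (closure (movedSet f.1))ᶜ)
      (hV.inter isClosed_closure.isOpen_compl) ⟨x, hxV, hx⟩
    have hfg : AlgDisjoint f g := by
      refine algDisjoint_of_disjoint hG fun y hy => hg y ?_
      exact fun hy' => hy'.2 (subset_closure hy)
    have hc : Commute (g ^ 12) k := h _ ⟨g, hfg, rfl⟩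
    obtain ⟨y, hy⟩ := exists_ne_of_ne_one hgn
    have hyV : y ∈ V := by
      by_contra hyV
      exact hy (pow_apply_eq (hg y fun h => hyV h.1) 12)
    have := commute_iff_apply.1 hc y
    rw [pow_apply_eq (hg (k.1 y) fun h => hkV y hyV h.1) 12] at this
    exact hy (k.1.injective this).symm
  · rintro h _ ⟨g, hg, rfl⟩
    refine (commute_of_disjoint (A := movedSet (g ^ 12).1) (B := closure (movedSet f.1))
      (fun x hx => not_not.1 hx) h ?_).eq
    refine Disjoint.closure_right ?_ (isOpen_movedSet _)
    rw [Set.disjoint_left]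
    exact fun x hx hx' => hx (hg.pow_apply_eq hG hx')

end Homeo

/-! ### The ring `ℤ[1/n]` and congruence modulo `n - 1` -/

/-- The ring `ℤ[1/n]`, as a subring of `ℝ`. -/
def nadic (n : ℕ) : Subring ℝ := Subring.closure {(n : ℝ)⁻¹}

theorem inv_mem_nadic (n : ℕ) : (n : ℝ)⁻¹ ∈ nadic n :=
  Subring.subset_closure rfl

theorem zpow_mem_nadic (n : ℕ) (k : ℤ) : (n : ℝ) ^ k ∈ nadic n := by
  obtain ⟨k, rfl | rfl⟩ := k.eq_nat_or_neg
  · rw [zpow_natCast]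
    exact pow_mem (natCast_mem _ _) _
  · rw [zpow_neg, zpow_natCast, ← inv_pow]
    exact pow_mem (inv_mem_nadic n) _

theorem mem_nadic_iff {n : ℕ} (hn : 2 ≤ n) {x : ℝ} :
    x ∈ nadic n ↔ ∃ (a : ℤ) (k : ℕ), x = (a : ℝ) / (n : ℝ) ^ k := by
  constructor
  · intro hx
    induction hx using Subring.closure_induction with
    | mem x hx => exact ⟨1, 1, by rw [Set.mem_singleton_iff.1 hx]; simp⟩
    | zero => exact ⟨0, 0, by simp⟩
    | one => exact ⟨1, 0, by simp⟩
    | add x y _ _ hx hy =>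
      obtain ⟨a, k, rfl⟩ := hx
      obtain ⟨b, l, rfl⟩ := hy
      exact ⟨a * n ^ l + b * n ^ k, k + l, by push_cast; field_simp; ring⟩
    | neg x _ hx =>
      obtain ⟨a, k, rfl⟩ := hx
      exact ⟨-a, k, by push_cast; ring⟩
    | mul x y _ _ hx hy =>
      obtain ⟨a, k, rfl⟩ := hx
      obtain ⟨b, l, rfl⟩ := hy
      exact ⟨a * b, k + l, by push_cast; field_simp; ring⟩
  · rintro ⟨a, k, rfl⟩
    have := zpow_mem_nadic n (-k)
    rw [zpow_neg, zpow_natCast] at this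
    exact mul_mem (intCast_mem _ _) this

/-- The subgroup `(n - 1) ℤ[1/n]` of `ℝ`. Affine maps with slope a power of `n` preserve lengths
modulo it. -/
def nadicIdeal (n : ℕ) : AddSubgroup ℝ :=
  (nadic n).toAddSubgroup.map (AddMonoidHom.mulLeft ((n : ℝ) - 1))

theorem mem_nadicIdeal_iff {n : ℕ} {x : ℝ} :
    x ∈ nadicIdeal n ↔ ∃ z ∈ nadic n, ((n : ℝ) - 1) * z = x := Iff.rfl

theorem zpow_mul_sub_mem {n : ℕ} (hn : 2 ≤ n) (k : ℤ) {x : ℝ} (hx : x ∈ nadic n) :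
    (n : ℝ) ^ k * x - x ∈ nadicIdeal n := by
  have h0 : (n : ℝ) ≠ 0 := by exact_mod_cast (show n ≠ 0 by omega)
  have key : ∀ (k : ℕ) {x : ℝ}, x ∈ nadic n → (n : ℝ) ^ k * x - x ∈ nadicIdeal n := by
    intro k x hx
    refine mem_nadicIdeal_iff.2 ⟨(∑ i ∈ Finset.range k, (n : ℝ) ^ i) * x,
      mul_mem (sum_mem fun i _ => pow_mem (natCast_mem _ _) _) hx, ?_⟩
    have := mul_geom_sum (n : ℝ) k
    rw [← mul_assoc, this]
    ring
  obtain ⟨k, rfl | rfl⟩ := k.eq_nat_or_neg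
  · rw [zpow_natCast]
    exact key k hx
  · have := neg_mem (key k (mul_mem (zpow_mem_nadic n (-k)) hx))
    rw [← mul_assoc, ← zpow_natCast, ← zpow_add₀ h0] at this
    simpa using this

theorem exists_int_sub_mem {n : ℕ} (hn : 2 ≤ n) {x : ℝ} (hx : x ∈ nadic n) :
    ∃ a : ℤ, x - a ∈ nadicIdeal n := by
  obtain ⟨a, k, rfl⟩ := (mem_nadic_iff hn).1 hx
  refine ⟨a, ?_⟩
  have := zpow_mul_sub_mem hn (-k) (intCast_mem (nadic n) a)
  rw [zpow_neg, zpow_natCast] at this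
  rwa [div_eq_inv_mul]

theorem dvd_of_intCast_mem_nadicIdeal {n : ℕ} (hn : 2 ≤ n) {a : ℤ}
    (ha : (a : ℝ) ∈ nadicIdeal n) : (n : ℤ) - 1 ∣ a := by
  obtain ⟨z, hz, hza⟩ := mem_nadicIdeal_iff.1 ha
  obtain ⟨b, k, rfl⟩ := (mem_nadic_iff hn).1 hz
  have h1 : ((n : ℤ) - 1) * b = (n : ℤ) ^ k * a := by
    have : ((n : ℝ) - 1) * b = (n : ℝ) ^ k * a := by
      rw [← hza]
      field_simp
    exact_mod_cast this
  have hco : IsCoprime ((n : ℤ) - 1) ((n : ℤ) ^ k) := by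
    refine IsCoprime.pow_right ⟨-1, 1, by ring⟩
  exact hco.dvd_of_dvd_mul_left ⟨b, h1.symm⟩

/-- Every residue class of `ℤ[1/n]` modulo `n - 1` is dense in `ℝ`. -/
theorem exists_mem_Ioo_sub_mem {n : ℕ} (hn : 2 ≤ n) {c u v : ℝ} (hc : c ∈ nadic n) (huv : u < v) :
    ∃ d ∈ nadic n, d ∈ Set.Ioo u v ∧ d - c ∈ nadicIdeal n := by
  have h2 : (2 : ℝ) ≤ n := by exact_mod_cast hn
  obtain ⟨N, hN⟩ := exists_pow_lt_of_lt_one (y := (n : ℝ)⁻¹) (x := (v - u) / (2 * ((n : ℝ) - 1)))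
    (div_pos (by linarith) (by linarith)) (inv_lt_one_of_one_lt₀ (by linarith))
  obtain ⟨T, hT⟩ : ∃ T, T = ((n : ℝ) - 1) * (n : ℝ)⁻¹ ^ N := ⟨_, rfl⟩
  have hT0 : 0 < T := by
    rw [hT]
    exact mul_pos (by linarith) (by positivity)
  have hT2 : 2 * T < v - u := by
    rw [lt_div_iff₀ (by linarith)] at hN
    rw [hT]
    linarith
  obtain ⟨j, ⟨hj1, hj2⟩, -⟩ := existsUnique_add_zsmul_mem_Ico hT0 c (u + T)
  have hmem : ∀ j : ℤ, j * (n : ℝ)⁻¹ ^ N ∈ nadic n := fun j =>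
    mul_mem (intCast_mem _ _) (pow_mem (inv_mem_nadic n) _)
  have hTn : T ∈ nadic n := by
    rw [hT]
    exact mul_mem (sub_mem (natCast_mem _ _) (one_mem _)) (pow_mem (inv_mem_nadic n) _)
  refine ⟨c + j • T, add_mem hc (zsmul_mem hTn _), ⟨by linarith, by linarith⟩, ?_⟩
  refine mem_nadicIdeal_iff.2 ⟨j * (n : ℝ)⁻¹ ^ N, hmem j, ?_⟩
  rw [zsmul_eq_mul, hT]
  ring

theorem exists_nadic_mem_Ioo {n : ℕ} (hn : 2 ≤ n) {u v : ℝ} (huv : u < v) :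
    ∃ d ∈ nadic n, d ∈ Set.Ioo u v := by
  obtain ⟨d, hd, hd', -⟩ := exists_mem_Ioo_sub_mem hn (zero_mem (nadic n)) huv
  exact ⟨d, hd, hd'⟩

theorem isNAdicPoint_coe_iff {n m : ℕ} (hn : 2 ≤ n) {x : ℝ} :
    IsNAdicPoint n m (x : AddCircle (m : ℝ)) ↔ x ∈ nadic n := by
  constructor
  · rintro ⟨a, k, h⟩
    have h1 : ((x - (a : ℝ) / (n : ℝ) ^ k : ℝ) : AddCircle (m : ℝ)) = 0 := by
      rw [AddCircle.coe_sub, h, sub_self]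
    obtain ⟨j, hj⟩ := (AddCircle.coe_eq_zero_iff (m : ℝ)).1 h1
    have h2 : x = (a : ℝ) / (n : ℝ) ^ k + j • (m : ℝ) := by rw [hj]; ring
    rw [h2]
    exact add_mem ((mem_nadic_iff hn).2 ⟨a, k, rfl⟩) (zsmul_mem (natCast_mem _ _) _)
  · intro h
    obtain ⟨a, k, rfl⟩ := (mem_nadic_iff hn).1 h
    exact ⟨a, k, rfl⟩

/-! ### Piecewise affine maps of intervals -/

/-- The restriction of `f` to `[a, b]` is an increasing piecewise affine map, with slopes powers of
`n` and breakpoints in `ℤ[1/n]`, that respects `ℤ[1/n]`. -/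
structure PLOn (n : ℕ) (f : ℝ → ℝ) (a b : ℝ) : Prop where
  mono : StrictMonoOn f (Set.Icc a b)
  cont : ContinuousOn f (Set.Icc a b)
  nadic_iff : ∀ t ∈ Set.Icc a b, (f t ∈ nadic n ↔ t ∈ nadic n)
  affine : ∃ B : Set ℝ, B.Finite ∧ (∀ x ∈ B, x ∈ nadic n) ∧ ∀ t ∈ Set.Ioo a b, t ∉ B →
    ∃ k : ℤ, ∀ᶠ s : ℝ in 𝓝 0, f (t + s) = f t + (n : ℝ) ^ k * s

theorem eventually_add_mem_Ioo {a b t : ℝ} (ht : t ∈ Set.Ioo a b) :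
    ∀ᶠ s : ℝ in 𝓝 0, t + s ∈ Set.Ioo a b := by
  have h : Continuous fun s : ℝ => t + s := by fun_prop
  have := h.tendsto 0
  rw [add_zero] at this
  exact this.eventually (Ioo_mem_nhds ht.1 ht.2)

theorem PLOn.congr {n : ℕ} {f g : ℝ → ℝ} {a b : ℝ} (h : PLOn n f a b)
    (hfg : ∀ t ∈ Set.Icc a b, g t = f t) : PLOn n g a b := by
  obtain ⟨h1, h2, h3, B, hB, hBn, hBa⟩ := h
  refine ⟨fun s hs t ht hst => ?_, h2.congr hfg, fun t ht => ?_, B, hB, hBn, fun t ht htB => ?_⟩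
  · rw [hfg s hs, hfg t ht]
    exact h1 hs ht hst
  · rw [hfg t ht]
    exact h3 t ht
  · obtain ⟨k, hk⟩ := hBa t ht htB
    refine ⟨k, ?_⟩
    filter_upwards [hk, eventually_add_mem_Ioo ht] with s hs hs'
    rw [hfg _ (Set.Ioo_subset_Icc_self hs'), hfg _ (Set.Ioo_subset_Icc_self ht), hs]

theorem PLOn.glue {n : ℕ} {f : ℝ → ℝ} {a b c : ℝ} (h : PLOn n f a b) (h' : PLOn n f b c)
    (hab : a ≤ b) (hbc : b ≤ c) (hb : b ∈ nadic n) : PLOn n f a c := by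
  obtain ⟨h1, h2, h3, B, hB, hBn, hBa⟩ := h
  obtain ⟨h1', h2', h3', B', hB', hBn', hBa'⟩ := h'
  have hU : Set.Icc a c = Set.Icc a b ∪ Set.Icc b c := (Set.Icc_union_Icc_eq_Icc hab hbc).symm
  refine ⟨?_, ?_, ?_, insert b (B ∪ B'), (hB.union hB').insert _, ?_, ?_⟩
  · rw [hU]
    exact h1.union h1' (isGreatest_Icc hab) (isLeast_Icc hbc)
  · rw [hU]
    exact h2.union_of_isClosed h2' isClosed_Icc isClosed_Icc
  · rw [hU]
    rintro t (ht | ht)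
    · exact h3 t ht
    · exact h3' t ht
  · rintro x (rfl | hx | hx)
    · exact hb
    · exact hBn x hx
    · exact hBn' x hx
  · intro t ht htB
    rcases lt_trichotomy t b with htb | rfl | htb
    · exact hBa t ⟨ht.1, htb⟩ fun h => htB (Or.inr (Or.inl h))
    · exact absurd (Or.inl rfl) htB
    · exact hBa' t ⟨htb, ht.2⟩ fun h => htB (Or.inr (Or.inr h))

theorem PLOn.piecewise {n : ℕ} {f g : ℝ → ℝ} {a b c : ℝ} (h : PLOn n f a b) (h' : PLOn n g b c)
    (hab : a ≤ b) (hbc : b ≤ c) (hb : b ∈ nadic n) (hfg : f b = g b) :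
    PLOn n (fun t => if t ≤ b then f t else g t) a c := by
  refine PLOn.glue (h.congr ?_) (h'.congr ?_) hab hbc hb
  · intro t ht
    rw [if_pos ht.2]
  · intro t ht
    rcases ht.1.eq_or_lt with rfl | htb
    · rw [if_pos le_rfl, hfg]
    · rw [if_neg (not_le.2 htb)]

theorem PLOn.linear {n : ℕ} (hn : 2 ≤ n) (k : ℤ) {c d : ℝ} (hc : c ∈ nadic n) (hd : d ∈ nadic n)
    (a b : ℝ) : PLOn n (fun t => c + (n : ℝ) ^ k * (t - d)) a b := by
  have h0 : (0 : ℝ) < n := by exact_mod_cast (show 0 < n by omega)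
  have hk : 0 < (n : ℝ) ^ k := zpow_pos h0 k
  refine ⟨fun s _ t _ hst => ?_, by fun_prop, fun t _ => ⟨fun h => ?_, fun h => ?_⟩, ∅,
    Set.finite_empty, by simp, fun t _ _ => ⟨k, ?_⟩⟩
  · have : (n : ℝ) ^ k * (s - d) < (n : ℝ) ^ k * (t - d) := by gcongr
    simpa using this
  · have h1 := mul_mem (zpow_mem_nadic n (-k)) (sub_mem h hc)
    rw [add_sub_cancel_left, ← mul_assoc, ← zpow_add₀ h0.ne'] at h1
    simp only [neg_add_cancel, zpow_zero, one_mul] at h1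
    simpa using add_mem h1 hd
  · exact add_mem hc (mul_mem (zpow_mem_nadic n k) (sub_mem h hd))
  · exact Eventually.of_forall fun s => by ring

theorem PLOn.id {n : ℕ} (hn : 2 ≤ n) (a b : ℝ) : PLOn n (fun t => t) a b :=
  (PLOn.linear hn 0 (zero_mem _) (zero_mem _) a b).congr fun t _ => by simp

/-- Two intervals with endpoints in `ℤ[1/n]` whose lengths agree modulo `n - 1` are related by a
piecewise affine map. Two pieces suffice: the slopes are the consecutive powers of `n` around the
ratio of the lengths, and the congruence says exactly that the breakpoint is in `ℤ[1/n]`. -/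
theorem exists_PLOn {n : ℕ} (hn : 2 ≤ n) {a b a' b' : ℝ} (ha : a ∈ nadic n) (hb : b ∈ nadic n)
    (ha' : a' ∈ nadic n) (hab : a < b) (hab' : a' < b')
    (h : (b' - a') - (b - a) ∈ nadicIdeal n) : ∃ f, PLOn n f a b ∧ f a = a' ∧ f b = b' := by
  have h2 : (2 : ℝ) ≤ n := by exact_mod_cast hn
  have h0 : (n : ℝ) ≠ 0 := by linarith
  obtain ⟨j, hj1, hj2⟩ := exists_mem_Ico_zpow (y := (n : ℝ))
    (div_pos (sub_pos.2 hab') (sub_pos.2 hab)) (by linarith)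
  rw [le_div_iff₀ (sub_pos.2 hab)] at hj1
  rw [div_lt_iff₀ (sub_pos.2 hab), zpow_add_one₀ h0] at hj2
  have h1 : (b' - a') - (n : ℝ) ^ j * (b - a) ∈ nadicIdeal n := by
    have := sub_mem h (zpow_mul_sub_mem hn j (sub_mem hb ha))
    convert this using 1
    ring
  obtain ⟨z, hz, hzx⟩ := mem_nadicIdeal_iff.1 h1
  obtain ⟨N, hN⟩ : ∃ N, N = (n : ℝ) ^ j := ⟨_, rfl⟩
  have hN0 : 0 < N := by rw [hN]; positivity
  obtain ⟨x, hxdef⟩ : ∃ x, x = z * (n : ℝ) ^ (-j) := ⟨_, rfl⟩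
  have hx : x ∈ nadic n := by
    rw [hxdef]
    exact mul_mem hz (zpow_mem_nadic n _)
  have hzN : z = N * x := by
    rw [hxdef, hN, zpow_neg]
    field_simp
  rw [← hN] at hj1 hj2 hzx
  rw [hzN] at hzx
  have hx0 : 0 ≤ x := by
    by_contra! hx0
    have : ((n : ℝ) - 1) * (N * x) < 0 :=
      mul_neg_of_pos_of_neg (by linarith) (mul_neg_of_pos_of_neg hN0 hx0)
    linarith
  have hxL : x ≤ b - a := by
    by_contra! hxL
    have : ((n : ℝ) - 1) * (N * (b - a)) < ((n : ℝ) - 1) * (N * x) := by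
      have : (0 : ℝ) < n - 1 := by linarith
      gcongr
    linarith
  have hax : a + x ∈ nadic n := add_mem ha hx
  have hax' : a' + n * N * x ∈ nadic n := by
    rw [hN]
    exact add_mem ha' (mul_mem (mul_mem (natCast_mem _ _) (zpow_mem_nadic n j)) hx)
  refine ⟨_, PLOn.piecewise (b := a + x) (PLOn.linear hn (j + 1) ha' ha a (a + x))
    (PLOn.linear hn j hax' hax (a + x) b) (by linarith) (by linarith) hax ?_, ?_, ?_⟩
  · rw [zpow_add_one₀ h0, ← hN]
    ring
  · rw [if_pos (by linarith)]
    ring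
  · rw [zpow_add_one₀ h0, ← hN]
    split_ifs with hbx
    · have : x = b - a := by linarith
      rw [this] at hzx
      linarith
    · linarith

/-- A piecewise affine map of `[p, q]` with `f t > t` in the interior: the slopes are `n`, `1` and
`1/n`. -/
theorem exists_PLOn_bump {n : ℕ} (hn : 2 ≤ n) {p q : ℝ} (hp : p ∈ nadic n) (hq : q ∈ nadic n)
    (hpq : p < q) : ∃ f, PLOn n f p q ∧ f p = p ∧ f q = q ∧
      ∀ t ∈ Set.Ioo p q, f t ∈ Set.Ioo t q := by
  have h2 : (2 : ℝ) ≤ n := by exact_mod_cast hn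
  obtain ⟨u, hu, hu0, huL⟩ := exists_nadic_mem_Ioo hn (u := 0) (v := (q - p) / (n + 1))
    (div_pos (by linarith) (by linarith))
  rw [lt_div_iff₀ (by linarith)] at huL
  have hnu : 0 < ((n : ℝ) - 1) * u := mul_pos (by linarith) hu0
  have hnu' : (n : ℝ) * u ∈ nadic n := mul_mem (natCast_mem _ _) hu
  have h1 := PLOn.linear hn 1 hp hp p (p + u)
  have h2' := PLOn.linear hn 0 (add_mem hp hnu') (add_mem hp hu) (p + u) (q - n * u)
  have h3 := PLOn.linear hn (-1) hq hq (q - n * u) q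
  have h12 := h1.piecewise h2' (by linarith) (by linarith) (add_mem hp hu)
    (by simp)
  have h123 := h12.piecewise h3 (by linarith) (by linarith) (sub_mem hq hnu') (by
    split_ifs with h
    · linarith
    · simp only [zpow_zero, one_mul, zpow_neg, zpow_one]
      field_simp
      ring)
  have hend : (fun t => if t ≤ q - n * u then (if t ≤ p + u then p + (n : ℝ) ^ (1 : ℤ) * (t - p)
      else p + n * u + (n : ℝ) ^ (0 : ℤ) * (t - (p + u))) else
      q + (n : ℝ) ^ (-1 : ℤ) * (t - q)) q = q := by
    have : ¬ q ≤ q - n * u := by linarith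
    simp only [if_neg this]
    ring
  refine ⟨_, h123, ?_, hend, ?_⟩
  · rw [if_pos (by linarith), if_pos (by linarith)]
    ring
  · intro t ht
    refine ⟨?_, ?_⟩
    · simp only [zpow_zero, one_mul, zpow_neg, zpow_one]
      split_ifs with h h'
      · nlinarith [mul_pos (show (0 : ℝ) < n - 1 by linarith) (sub_pos.2 ht.1)]
      · linarith
      · have e : q + (n : ℝ)⁻¹ * (t - q) - t = (1 - (n : ℝ)⁻¹) * (q - t) := by ring
        have : 0 < (1 - (n : ℝ)⁻¹) * (q - t) :=
          mul_pos (sub_pos.2 (inv_lt_one_of_one_lt₀ (by linarith))) (sub_pos.2 ht.2)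
        linarith
    · have := h123.mono (Set.Ioo_subset_Icc_self ht) (Set.right_mem_Icc.2 hpq.le) ht.2
      exact this.trans_eq hend

/-! ### From piecewise affine maps to elements of the group -/

theorem exists_coe_mem_Ico {m : ℕ} (hm : 2 ≤ m) (a : ℝ) (x : AddCircle (m : ℝ)) :
    ∃ t ∈ Set.Ico a (a + m), (t : AddCircle (m : ℝ)) = x := by
  have hm0 : (0 : ℝ) < m := by exact_mod_cast (show 0 < m by omega)
  have : Fact ((0 : ℝ) < m) := ⟨hm0⟩
  have : x ∈ ((↑) : ℝ → AddCircle (m : ℝ)) '' Set.Ico a (a + m) := by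
    rw [AddCircle.coe_image_Ico_eq]
    trivial
  exact this

/-- A piecewise affine map of `[a, a + m]` that shifts the two endpoints by the same amount descends
to an element of `HigmanThompsonT n m`. -/
theorem PLOn.exists_mem {n m : ℕ} (hn : 2 ≤ n) (hm : 2 ≤ m) {f : ℝ → ℝ} {a : ℝ}
    (ha : a ∈ nadic n) (h : PLOn n f a (a + m)) (hf : f (a + m) = f a + m) :
    ∃ g : HigmanThompsonT n m, ∀ t ∈ Set.Icc a (a + m),
      g.1 (t : AddCircle (m : ℝ)) = (f t : AddCircle (m : ℝ)) := by
  have hm0 : (0 : ℝ) < m := by exact_mod_cast (show 0 < m by omega)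
  have : Fact ((0 : ℝ) < m) := ⟨hm0⟩
  obtain ⟨h1, h2, h3, B, hB, hBn, hBa⟩ := h
  obtain ⟨F, hF⟩ : ∃ F : ℝ → AddCircle (m : ℝ), F = fun t => (f t : AddCircle (m : ℝ)) := ⟨_, rfl⟩
  have hFa : F a = F (a + m) := by
    simp only [hF, hf, AddCircle.coe_add_period]
  have hcont : Continuous (AddCircle.liftIco (m : ℝ) a F) := by
    refine AddCircle.liftIco_continuous hFa ?_
    rw [hF]
    exact (AddCircle.continuous_mk' (m : ℝ)).comp_continuousOn h2
  have hval : ∀ t ∈ Set.Icc a (a + m), AddCircle.liftIco (m : ℝ) a F (t : AddCircle (m : ℝ)) =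
      (f t : AddCircle (m : ℝ)) := by
    intro t ht
    rcases ht.2.eq_or_lt with rfl | htm
    · rw [AddCircle.coe_add_period, AddCircle.liftIco_coe_apply ⟨le_rfl, by linarith⟩, hFa, hF]
    · rw [AddCircle.liftIco_coe_apply ⟨ht.1, htm⟩, hF]
  have hrep := exists_coe_mem_Ico hm a
  have hrange : ∀ t ∈ Set.Ico a (a + m), f t ∈ Set.Ico (f a) (f a + m) := by
    intro t ht
    have ha' : a ∈ Set.Icc a (a + m) := ⟨le_rfl, by linarith⟩
    have hb' : a + m ∈ Set.Icc a (a + (m : ℝ)) := ⟨by linarith, le_rfl⟩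
    refine ⟨h1.monotoneOn ha' (Set.Ico_subset_Icc_self ht) ht.1, ?_⟩
    rw [← hf]
    exact h1 (Set.Ico_subset_Icc_self ht) hb' ht.2
  have hinj : Function.Injective (AddCircle.liftIco (m : ℝ) a F) := by
    intro x y hxy
    obtain ⟨s, hs, rfl⟩ := hrep x
    obtain ⟨t, ht, rfl⟩ := hrep y
    rw [hval s (Set.Ico_subset_Icc_self hs), hval t (Set.Ico_subset_Icc_self ht),
      AddCircle.coe_eq_coe_iff_of_mem_Ico (hrange s hs) (hrange t ht)] at hxy
    rw [h1.injOn (Set.Ico_subset_Icc_self hs) (Set.Ico_subset_Icc_self ht) hxy]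
  have hsurj : Function.Surjective (AddCircle.liftIco (m : ℝ) a F) := by
    intro y
    have : y ∈ ((↑) : ℝ → AddCircle (m : ℝ)) '' Set.Ico (f a) (f a + m) := by
      rw [AddCircle.coe_image_Ico_eq]
      trivial
    obtain ⟨w, hw, rfl⟩ := this
    obtain ⟨t, ht, rfl⟩ := intermediate_value_Icc (by linarith) h2
      (show w ∈ Set.Icc (f a) (f (a + m)) from ⟨hw.1, by rw [hf]; exact hw.2.le⟩)
    exact ⟨t, hval t ht⟩
  let e : AddCircle (m : ℝ) ≃ₜ AddCircle (m : ℝ) := Continuous.homeoOfEquivCompactToT2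
    (f := Equiv.ofBijective _ ⟨hinj, hsurj⟩) hcont
  have he : ∀ t ∈ Set.Icc a (a + m), e (t : AddCircle (m : ℝ)) = (f t : AddCircle (m : ℝ)) := hval
  refine ⟨⟨e, ⟨insert (a : AddCircle (m : ℝ)) ((↑) '' B), (hB.image _).insert _, ?_, ?_⟩, ?_⟩, he⟩
  · rintro _ (rfl | ⟨x, hx, rfl⟩)
    · exact (isNAdicPoint_coe_iff hn).2 ha
    · exact (isNAdicPoint_coe_iff hn).2 (hBn x hx)
  · intro x hx
    obtain ⟨t, ht, rfl⟩ := hrep x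
    have hat : a ≠ t := by
      rintro rfl
      exact hx (Or.inl rfl)
    have ht' : t ∈ Set.Ioo a (a + m) := ⟨lt_of_le_of_ne ht.1 hat, ht.2⟩
    obtain ⟨k, hk⟩ := hBa t ht' fun h => hx (Or.inr ⟨t, h, rfl⟩)
    refine ⟨k, ?_⟩
    filter_upwards [hk, eventually_add_mem_Ioo ht'] with s hs hs'
    rw [← AddCircle.coe_add, he _ (Set.Ioo_subset_Icc_self hs'),
      he _ (Set.Ioo_subset_Icc_self ht'), hs, AddCircle.coe_add]
  · intro x
    obtain ⟨t, ht, rfl⟩ := hrep x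
    rw [he t (Set.Ico_subset_Icc_self ht), isNAdicPoint_coe_iff hn, isNAdicPoint_coe_iff hn]
    exact h3 t (Set.Ico_subset_Icc_self ht)

theorem exists_bump {n m : ℕ} (hn : 2 ≤ n) (hm : 2 ≤ m) {p q : ℝ} (hp : p ∈ nadic n)
    (hq : q ∈ nadic n) (hpq : p < q) (hqm : q ≤ p + m) : ∃ g : HigmanThompsonT n m,
      (∀ t ∈ Set.Icc q (p + m), g.1 (t : AddCircle (m : ℝ)) = t) ∧
      ∀ t ∈ Set.Ioo p q, ∀ i : ℕ, i ≠ 0 →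
        ∃ t' ∈ Set.Ioo t q, (g ^ i).1 (t : AddCircle (m : ℝ)) = t' := by
  obtain ⟨f, hf, hfp, hfq, hft⟩ := exists_PLOn_bump hn hp hq hpq
  have hpm : p + m ≠ p := by
    have : m ≠ 0 := by omega
    simpa using this
  have h := hf.piecewise (PLOn.id hn q (p + m)) hpq.le hqm hq hfq
  obtain ⟨g, hg⟩ := h.exists_mem hn hm hp (by
    rw [if_pos hpq.le, hfp]
    split_ifs with h'
    · have : p + m = q := le_antisymm h' hqm
      rw [this, hfq]
    · rfl)
  refine ⟨g, fun t ht => ?_, fun t ht i hi => ?_⟩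
  · rw [hg t ⟨hpq.le.trans ht.1, ht.2⟩]
    split_ifs with h'
    · rw [le_antisymm h' ht.1, hfq]
    · rfl
  · have hstep : ∀ t ∈ Set.Ioo p q, g.1 (t : AddCircle (m : ℝ)) = f t := by
      intro t ht
      rw [hg t ⟨ht.1.le, ht.2.le.trans hqm⟩, if_pos ht.2.le]
    obtain ⟨i, rfl⟩ := Nat.exists_eq_succ_of_ne_zero hi
    clear hi
    induction i with
    | zero => exact ⟨f t, hft t ht, by simpa using hstep t ht⟩
    | succ i ih =>
      obtain ⟨t', ht', ih⟩ := ih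
      have ht'' : t' ∈ Set.Ioo p q := ⟨ht.1.trans ht'.1, ht'.2⟩
      refine ⟨f t', ⟨ht'.1.trans (hft t' ht'').1, (hft t' ht'').2⟩, ?_⟩
      rw [pow_succ']
      change g.1 ((g ^ (i + 1)).1 t) = _
      rw [ih, hstep t' ht'']

theorem exists_map_nadic {n m : ℕ} (hn : 2 ≤ n) (hm : 2 ≤ m) {p q x y : ℝ} (hp : p ∈ nadic n)
    (hq : q ∈ nadic n) (hx : x ∈ nadic n) (hy : y ∈ nadic n) (hqm : q < p + m)
    (hxI : x ∈ Set.Ioo p q) (hyI : y ∈ Set.Ioo p q) (hxy : y - x ∈ nadicIdeal n) :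
    ∃ g : HigmanThompsonT n m, (∀ t ∈ Set.Icc q (p + m), g.1 (t : AddCircle (m : ℝ)) = t) ∧
      g.1 (x : AddCircle (m : ℝ)) = y := by
  obtain ⟨f₁, hf₁, hf₁p, hf₁x⟩ := exists_PLOn hn hp hx hp hxI.1 hyI.1
    (by convert hxy using 1; ring)
  obtain ⟨f₂, hf₂, hf₂x, hf₂q⟩ := exists_PLOn hn hx hq hy hxI.2 hyI.2
    (by convert neg_mem hxy using 1; ring)
  have hpq := hxI.1.trans hxI.2
  have h12 := hf₁.piecewise hf₂ hxI.1.le hxI.2.le hx (hf₁x.trans hf₂x.symm)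
  have h := h12.piecewise (PLOn.id hn q (p + m)) hpq.le hqm.le hq
    (by rw [if_neg (not_le.2 hxI.2), hf₂q])
  obtain ⟨g, hg⟩ := h.exists_mem hn hm hp (by
    rw [if_pos hpq.le, if_pos hxI.1.le, hf₁p, if_neg (not_le.2 hqm)])
  refine ⟨g, fun t ht => ?_, ?_⟩
  · rw [hg t ⟨hpq.le.trans ht.1, ht.2⟩]
    split_ifs with h1 h2
    · exact absurd h2 (not_le.2 (hxI.2.trans_le ht.1))
    · rw [le_antisymm h1 ht.1, hf₂q]
    · rfl
  · rw [hg x ⟨hxI.1.le, (hxI.2.trans hqm).le⟩, if_pos hxI.2.le, if_pos le_rfl, hf₁x]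

/-- Arcs with congruent lengths are exchanged by the group; the conclusion records the effect on the
complementary arcs. -/
theorem exists_map_arc {n m : ℕ} (hn : 2 ≤ n) (hm : 2 ≤ m) {p q p' q' : ℝ} (hp : p ∈ nadic n)
    (hq : q ∈ nadic n) (hp' : p' ∈ nadic n) (hq' : q' ∈ nadic n) (hpq : p < q) (hqm : q < p + m)
    (hpq' : p' < q') (hqm' : q' < p' + m) (h : (q' - p') - (q - p) ∈ nadicIdeal n) :
    ∃ g : HigmanThompsonT n m,
      (∀ t ∈ Set.Icc q (p + m), ∃ t' ∈ Set.Icc q' (p' + m), g.1 (t : AddCircle (m : ℝ)) = t') ∧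
      ∀ t' ∈ Set.Icc q' (p' + m), ∃ t ∈ Set.Icc q (p + m), g.1 (t : AddCircle (m : ℝ)) = t' := by
  have hpm : p + m ∈ nadic n := add_mem hp (natCast_mem _ _)
  obtain ⟨f₁, hf₁, hf₁p, hf₁q⟩ := exists_PLOn hn hp hq hp' hpq hpq' h
  obtain ⟨f₂, hf₂, hf₂q, hf₂p⟩ := exists_PLOn hn hq hpm hq' hqm hqm'
    (by convert neg_mem h using 1; ring)
  have hG := hf₁.piecewise hf₂ hpq.le hqm.le hq (hf₁q.trans hf₂q.symm)
  obtain ⟨g, hg⟩ := hG.exists_mem hn hm hp (by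
    rw [if_pos hpq.le, if_neg (not_le.2 hqm), hf₁p, hf₂p])
  have hg2 : ∀ t ∈ Set.Icc q (p + m), g.1 (t : AddCircle (m : ℝ)) = f₂ t := by
    intro t ht
    rw [hg t ⟨hpq.le.trans ht.1, ht.2⟩]
    split_ifs with h1
    · rw [le_antisymm h1 ht.1, hf₁q, hf₂q]
    · rfl
  refine ⟨g, fun t ht => ⟨f₂ t, ⟨?_, ?_⟩, hg2 t ht⟩, fun t' ht' => ?_⟩
  · rw [← hf₂q]
    exact hf₂.mono.monotoneOn (Set.left_mem_Icc.2 hqm.le) ht ht.1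
  · rw [← hf₂p]
    exact hf₂.mono.monotoneOn ht (Set.right_mem_Icc.2 hqm.le) ht.2
  · obtain ⟨t, ht, rfl⟩ := intermediate_value_Icc hqm.le hf₂.cont
      (show t' ∈ Set.Icc (f₂ q) (f₂ (p + m)) by rwa [hf₂q, hf₂p])
    exact ⟨t, ht, hg2 t ht⟩

/-! ### Lifts to the real line -/

theorem coe_eq_coe_iff_exists {m : ℕ} {s t : ℝ} :
    (s : AddCircle (m : ℝ)) = t ↔ ∃ j : ℤ, s = t + j * m := by
  rw [← sub_eq_zero, ← AddCircle.coe_sub, AddCircle.coe_eq_zero_iff]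
  constructor
  · rintro ⟨j, hj⟩
    rw [zsmul_eq_mul] at hj
    exact ⟨j, by linarith⟩
  · rintro ⟨j, hj⟩
    exact ⟨j, by rw [zsmul_eq_mul]; linarith⟩

theorem eq_of_coe_eq {m : ℕ} {s t : ℝ} (h : (s : AddCircle (m : ℝ)) = t) (hst : |s - t| < m) :
    s = t := by
  obtain ⟨j, hj⟩ := coe_eq_coe_iff_exists.1 h
  have h1 : s - t = j * m := by linarith
  rw [h1, abs_mul, Nat.abs_cast] at hst
  have h2 : |(j : ℝ)| < 1 := by
    by_contra! h2
    nlinarith [Nat.cast_nonneg (α := ℝ) m]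
  have h3 : j = 0 := by
    rw [← Int.cast_abs] at h2
    have : |j| < 1 := by exact_mod_cast h2
    exact Int.abs_lt_one_iff.1 this
  rw [hj, h3]
  simp

/-- `F` is a continuous lift to `ℝ` of the homeomorphism `g` of `ℝ/mℤ`. -/
structure IsLift (m : ℕ) (g : AddCircle (m : ℝ) ≃ₜ AddCircle (m : ℝ)) (F : ℝ → ℝ) : Prop where
  cont : Continuous F
  coe_apply : ∀ t : ℝ, (F t : AddCircle (m : ℝ)) = g t

theorem exists_isLift {m : ℕ} (g : AddCircle (m : ℝ) ≃ₜ AddCircle (m : ℝ))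
    {a a' : ℝ} (h : g a = a') : ∃ F, IsLift m g F ∧ F a = a' := by
  obtain ⟨F, ⟨hF1, hF2⟩, -⟩ :=
    (AddCircle.isCoveringMap_coe (m : ℝ)).existsUnique_continuousMap_lifts
      (A := ℝ) ⟨fun t => g t, g.continuous.comp (AddCircle.continuous_mk' _)⟩ a a' h.symm
  exact ⟨F, ⟨F.continuous, fun t => congrFun hF2 t⟩, hF1⟩

theorem IsLift.affine {n m : ℕ} (hm : 2 ≤ m) {g : AddCircle (m : ℝ) ≃ₜ AddCircle (m : ℝ)}
    {F : ℝ → ℝ} (hF : IsLift m g F) {t : ℝ} (h : IsLocallyAffineAt n m g t) :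
    ∃ k : ℤ, ∀ᶠ s : ℝ in 𝓝 0, F (t + s) = F t + (n : ℝ) ^ k * s := by
  have hm0 : (0 : ℝ) < m := by exact_mod_cast (show 0 < m by omega)
  obtain ⟨k, hk⟩ := h
  refine ⟨k, ?_⟩
  have hc : Continuous fun s => |F (t + s) - (F t + (n : ℝ) ^ k * s)| := by
    have := hF.cont
    fun_prop
  have h1 : ∀ᶠ s in 𝓝 (0 : ℝ), |F (t + s) - (F t + (n : ℝ) ^ k * s)| < m :=
    (hc.tendsto 0).eventually_lt_const (by simpa using hm0)
  filter_upwards [hk, h1] with s hs hs1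
  refine eq_of_coe_eq ?_ hs1
  rw [hF.coe_apply, AddCircle.coe_add, hs, AddCircle.coe_add, hF.coe_apply]

/-- A continuous function that is locally affine, with slopes powers of `n`, in the interior of an
interval is affine on the interval. -/
theorem affine_on_Icc {n : ℕ} {F : ℝ → ℝ} (hF : Continuous F) {a b : ℝ} (hab : a < b)
    (h : ∀ t ∈ Set.Ioo a b, ∃ k : ℤ, ∀ᶠ s : ℝ in 𝓝 0, F (t + s) = F t + (n : ℝ) ^ k * s) :
    ∃ k : ℤ, ∀ t ∈ Set.Icc a b, F t = F a + (n : ℝ) ^ k * (t - a) := by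
  have hev : ∀ t ∈ Set.Ioo a b, ∃ k : ℤ, ∀ᶠ u in 𝓝 t, HasDerivAt F ((n : ℝ) ^ k) u := by
    intro t ht
    obtain ⟨k, hk⟩ := h t ht
    refine ⟨k, ?_⟩
    have hc : Tendsto (fun u : ℝ => u - t) (𝓝 t) (𝓝 0) := by
      have : Continuous fun u : ℝ => u - t := by fun_prop
      simpa using this.tendsto t
    filter_upwards [(hc.eventually hk).eventually_nhds] with u hu
    have h1 : HasDerivAt (fun u => F t + (n : ℝ) ^ k * (u - t)) ((n : ℝ) ^ k) u := by
      simpa using ((((hasDerivAt_id u).sub_const t).const_mul ((n : ℝ) ^ k)).const_add (F t))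
    refine h1.congr_of_eventuallyEq ?_
    filter_upwards [hu] with v hv
    rw [← hv]
    congr 1
    ring
  obtain ⟨c, hc⟩ : ∃ c, c ∈ Set.Ioo a b := Set.nonempty_Ioo.2 hab
  obtain ⟨k, hk⟩ := hev c hc
  have hconst : ∀ t ∈ Set.Ioo a b, deriv F t = (n : ℝ) ^ k := by
    intro t ht
    rw [← hk.self_of_nhds.deriv]
    have hd : ∀ t ∈ Set.Ioo a b, HasDerivAt (deriv F) 0 t := by
      intro t ht
      obtain ⟨l, hl⟩ := hev t ht
      refine (hasDerivAt_const t ((n : ℝ) ^ l)).congr_of_eventuallyEq ?_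
      filter_upwards [hl] with u hu
      exact hu.deriv
    exact isOpen_Ioo.is_const_of_deriv_eq_zero isPreconnected_Ioo
      (fun t ht => (hd t ht).differentiableAt.differentiableWithinAt)
      (fun t ht => (hd t ht).deriv) ht hc
  have hconst' : ∀ t ∈ Set.Ioo a b, F t = F c + (n : ℝ) ^ k * (t - c) := by
    intro t ht
    have hd : ∀ t ∈ Set.Ioo a b, HasDerivAt (fun t => F t - (n : ℝ) ^ k * t) 0 t := by
      intro t ht
      obtain ⟨l, hl⟩ := hev t ht
      have h1 := hl.self_of_nhds.differentiableAt.hasDerivAt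
      rw [hconst t ht] at h1
      have h2 := h1.fun_sub ((hasDerivAt_id t).const_mul ((n : ℝ) ^ k))
      rw [mul_one, sub_self] at h2
      exact h2
    have := isOpen_Ioo.is_const_of_deriv_eq_zero isPreconnected_Ioo
      (fun t ht => (hd t ht).differentiableAt.differentiableWithinAt)
      (fun t ht => (hd t ht).deriv) ht hc
    linarith
  have hcl : Set.EqOn F (fun t => F c + (n : ℝ) ^ k * (t - c)) (Set.Icc a b) := by
    rw [← closure_Ioo hab.ne]
    exact Set.EqOn.closure hconst' hF (by fun_prop)
  refine ⟨k, fun t ht => ?_⟩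
  have h1 := hcl ht
  have h2 := hcl (Set.left_mem_Icc.2 hab.le)
  simp only at h1 h2
  rw [h1, h2]
  ring

theorem finite_preimage_coe_inter_Icc {m : ℕ} (hm : 2 ≤ m) {B : Set (AddCircle (m : ℝ))}
    (hB : B.Finite) (a b : ℝ) : {t : ℝ | (t : AddCircle (m : ℝ)) ∈ B ∧ t ∈ Set.Icc a b}.Finite := by
  have hm0 : (0 : ℝ) < m := by exact_mod_cast (show 0 < m by omega)
  have : {t : ℝ | (t : AddCircle (m : ℝ)) ∈ B ∧ t ∈ Set.Icc a b} ⊆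
      ⋃ x ∈ B, {t : ℝ | (t : AddCircle (m : ℝ)) = x ∧ t ∈ Set.Icc a b} := by
    rintro t ⟨h1, h2⟩
    simp only [Set.mem_iUnion]
    exact ⟨_, h1, rfl, h2⟩
  refine Set.Finite.subset (hB.biUnion fun x _ => ?_) this
  obtain ⟨c, -, rfl⟩ := exists_coe_mem_Ico hm 0 x
  refine Set.Finite.subset ((Set.finite_Icc ⌈(a - c) / m⌉ ⌊(b - c) / m⌋).image
    fun j : ℤ => c + j * m) ?_
  rintro t ⟨h1, h2, h3⟩
  obtain ⟨j, rfl⟩ := coe_eq_coe_iff_exists.1 h1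
  refine ⟨j, ⟨?_, ?_⟩, rfl⟩
  · rw [Int.ceil_le, div_le_iff₀ hm0]
    linarith
  · rw [Int.le_floor, le_div_iff₀ hm0]
    linarith

section Lift

variable {n m : ℕ} {g : HigmanThompsonT n m} {F : ℝ → ℝ}

theorem IsLift.affine_of_notMem (hn : 2 ≤ n) (hm : 2 ≤ m) (hF : IsLift m g.1 F) {t : ℝ}
    (ht : t ∉ nadic n) : ∃ k : ℤ, ∀ᶠ s : ℝ in 𝓝 0, F (t + s) = F t + (n : ℝ) ^ k * s := by
  obtain ⟨⟨B, hB, hBn, hBa⟩, -⟩ := g.2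
  exact hF.affine hm (hBa _ fun h => ht ((isNAdicPoint_coe_iff hn).1 (hBn _ h)))

/-- To the right of every point, including the breakpoints, a lift is affine. -/
theorem IsLift.affine_right (hm : 2 ≤ m) (hF : IsLift m g.1 F) (t : ℝ) :
    ∃ k : ℤ, ∃ ε > 0, ∀ s ∈ Set.Icc 0 ε, F (t + s) = F t + (n : ℝ) ^ k * s := by
  obtain ⟨⟨B, hB, hBn, hBa⟩, -⟩ := g.2
  have hfin : {u : ℝ | (u : AddCircle (m : ℝ)) ∈ B ∧ u ∈ Set.Icc t (t + 1)}.Finite :=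
    finite_preimage_coe_inter_Icc hm hB t (t + 1)
  have hfin' := (hfin.subset (Set.sdiff_subset (t := {t}))).isClosed.isOpen_compl.mem_nhds
    (x := t) (by simp)
  obtain ⟨δ, hδ, hδB⟩ := Metric.mem_nhds_iff.1 hfin'
  have hε : 0 < min (δ / 2) 1 := by positivity
  obtain ⟨k, hk⟩ := affine_on_Icc (n := n) hF.cont (a := t) (b := t + min (δ / 2) 1)
    (by linarith) (by
      intro u hu
      refine hF.affine hm (hBa _ fun h => ?_)
      have h1 : u ∈ Metric.ball t δ := by
        rw [Metric.mem_ball, Real.dist_eq, abs_lt]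
        have := min_le_left (δ / 2) 1
        constructor <;> linarith [hu.1, hu.2]
      refine hδB h1 ⟨⟨h, hu.1.le, ?_⟩, hu.1.ne'⟩
      have := min_le_right (δ / 2) 1
      linarith [hu.2])
  refine ⟨k, _, hε, fun s hs => ?_⟩
  rw [hk (t + s) ⟨by linarith [hs.1], by linarith [hs.2]⟩]
  ring

/-- A lift is increasing, and changes distances between points of `ℤ[1/n]` only by elements of
`(n - 1) ℤ[1/n]`. Both statements pass from two adjacent intervals to their union, and they hold on
intervals without breakpoints. -/
theorem IsLift.lt_and_sub_mem (hn : 2 ≤ n) (hm : 2 ≤ m) (hF : IsLift m g.1 F) {a b : ℝ}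
    (hab : a < b) : F a < F b ∧
      (a ∈ nadic n → b ∈ nadic n → (F b - F a) - (b - a) ∈ nadicIdeal n) := by
  obtain ⟨⟨B, hB, hBn, hBa⟩, -⟩ := g.2
  have h0 : (0 : ℝ) < n := by exact_mod_cast (show 0 < n by omega)
  have hfin : ∀ a b : ℝ, {t : ℝ | (t : AddCircle (m : ℝ)) ∈ B ∧ t ∈ Set.Ioo a b}.Finite :=
    fun a b => (finite_preimage_coe_inter_Icc hm hB a b).subset
      fun t ht => ⟨ht.1, Set.Ioo_subset_Icc_self ht.2⟩
  induction hN : {t : ℝ | (t : AddCircle (m : ℝ)) ∈ B ∧ t ∈ Set.Ioo a b}.ncard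
    using Nat.strong_induction_on generalizing a b with
  | _ N ih =>
    by_cases hemp : ∃ c : ℝ, (c : AddCircle (m : ℝ)) ∈ B ∧ c ∈ Set.Ioo a b
    · obtain ⟨c, hcB, hc⟩ := hemp
      have hcn : c ∈ nadic n := (isNAdicPoint_coe_iff hn).1 (hBn _ hcB)
      obtain ⟨i1, i2⟩ := ih _ (by
        rw [← hN]
        refine Set.ncard_lt_ncard ⟨fun t ht => ⟨ht.1, ht.2.1, ht.2.2.trans hc.2⟩, fun hsub => ?_⟩
          (hfin a b)
        exact lt_irrefl c (hsub ⟨hcB, hc⟩).2.2) hc.1 rfl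
      obtain ⟨j1, j2⟩ := ih _ (by
        rw [← hN]
        refine Set.ncard_lt_ncard ⟨fun t ht => ⟨ht.1, hc.1.trans ht.2.1, ht.2.2⟩, fun hsub => ?_⟩
          (hfin a b)
        exact lt_irrefl c (hsub ⟨hcB, hc⟩).2.1) hc.2 rfl
      refine ⟨i1.trans j1, fun ha hb => ?_⟩
      convert add_mem (i2 ha hcn) (j2 hcn hb) using 1
      ring
    · push Not at hemp
      obtain ⟨k, hk⟩ := affine_on_Icc (n := n) hF.cont hab
        fun t ht => hF.affine hm (hBa _ fun h => hemp t h ht)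
      have hk' := hk b (Set.right_mem_Icc.2 hab.le)
      refine ⟨?_, fun ha hb => ?_⟩
      · rw [hk']
        have : 0 < (n : ℝ) ^ k * (b - a) := mul_pos (zpow_pos h0 k) (sub_pos.2 hab)
        linarith
      · convert zpow_mul_sub_mem hn k (sub_mem hb ha) using 1
        rw [hk']
        ring

theorem IsLift.strictMono (hn : 2 ≤ n) (hm : 2 ≤ m) (hF : IsLift m g.1 F) : StrictMono F :=
  fun _ _ hab => (hF.lt_and_sub_mem hn hm hab).1

theorem IsLift.add_period (hn : 2 ≤ n) (hm : 2 ≤ m) (hF : IsLift m g.1 F) (t : ℝ) :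
    F (t + m) = F t + m := by
  have hm0 : (0 : ℝ) < m := by exact_mod_cast (show 0 < m by omega)
  have hmono := hF.strictMono hn hm
  obtain ⟨j, hj⟩ : ∃ j : ℤ, F (t + m) = F t + j * m := by
    rw [← coe_eq_coe_iff_exists, hF.coe_apply, hF.coe_apply, AddCircle.coe_add_period]
  have hj1 : 1 ≤ j := by
    have h1 := hmono (show t < t + m by linarith)
    rw [hj] at h1
    have h2 : 0 < (j : ℝ) := by
      by_contra! h
      nlinarith
    have h3 : 0 < j := by exact_mod_cast h2
    omega
  have hj2 : j ≤ 1 := by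
    by_contra! h
    have h2 : (2 : ℝ) ≤ j := by exact_mod_cast h
    obtain ⟨y, hy, hFy⟩ := intermediate_value_Icc (show t ≤ t + m by linarith) hF.cont.continuousOn
      (show F t + m ∈ Set.Icc (F t) (F (t + m)) from ⟨by linarith, by rw [hj]; nlinarith⟩)
    have hyt : (y : AddCircle (m : ℝ)) = t := by
      apply g.1.injective
      rw [← hF.coe_apply, ← hF.coe_apply, hFy, AddCircle.coe_add_period]
    have h3 : y ≠ t + m := by
      rintro rfl
      rw [hj] at hFy
      nlinarith
    have h4 : y = t := eq_of_coe_eq hyt (by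
      rw [abs_lt]
      constructor
      · linarith [hy.1]
      · linarith [lt_of_le_of_ne hy.2 h3])
    rw [h4] at hFy
    linarith
  have hj3 : j = 1 := by omega
  rw [hj, hj3]
  simp

/-- For a lift with a fixed point, fixed points upstairs and downstairs correspond. -/
theorem IsLift.apply_eq_iff (hn : 2 ≤ n) (hm : 2 ≤ m) (hF : IsLift m g.1 F) {a : ℝ}
    (ha : F a = a) (t : ℝ) : g.1 (t : AddCircle (m : ℝ)) = t ↔ F t = t := by
  rw [← hF.coe_apply]
  refine ⟨fun h => ?_, fun h => by rw [h]⟩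
  have hmono := hF.strictMono hn hm
  have hper : ∀ j : ℕ, ∀ u, F u = u → F (u + j * m) = u + j * m := by
    intro j u hu
    induction j with
    | zero => simpa using hu
    | succ j ih =>
      have := hF.add_period hn hm (u + j * m)
      rw [ih] at this
      have e : u + (j + 1 : ℕ) * m = u + j * (m : ℝ) + m := by push_cast; ring
      rw [e, this]
  have hneg : ∀ j : ℕ, ∀ u, F u = u → F (u - j * m) = u - j * m := by
    intro j u hu
    induction j with
    | zero => simpa using hu
    | succ j ih =>
      have := hF.add_period hn hm (u - (j + 1 : ℕ) * m)
      have e : u - (j + 1 : ℕ) * m + m = u - j * (m : ℝ) := by push_cast; ring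
      rw [e, ih] at this
      linarith
  have hall : ∀ j : ℤ, F (a + j * m) = a + j * m := by
    intro j
    obtain ⟨j, rfl | rfl⟩ := j.eq_nat_or_neg
    · exact hper j a ha
    · have e : a + ((-j : ℤ) : ℝ) * m = a - j * m := by push_cast; ring
      rw [e, hneg j a ha]
  have hm0 : (0 : ℝ) < m := by exact_mod_cast (show 0 < m by omega)
  obtain ⟨j, ⟨hj1, hj2⟩, -⟩ := existsUnique_add_zsmul_mem_Ico hm0 a (t - m)
  rw [zsmul_eq_mul] at hj1 hj2
  have e : a + ((j + 1 : ℤ) : ℝ) * m = a + j * m + m := by push_cast; ring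
  have h2 := hmono.monotone (show t ≤ a + ((j + 1 : ℤ) : ℝ) * m by rw [e]; linarith)
  rw [hall, e] at h2
  rcases (show a + j * m ≤ t by linarith).eq_or_lt with h3 | h3
  · rw [← h3, hall]
  · have h1 := hmono h3
    rw [hall] at h1
    exact eq_of_coe_eq h (by rw [abs_lt]; constructor <;> linarith)

end Lift

/-! ### Arc subgroups of the Higman–Thompson groups -/

section Arc

variable {n m : ℕ}

theorem locallyMoving_higmanThompsonT (hn : 2 ≤ n) (hm : 2 ≤ m) :
    LocallyMoving (HigmanThompsonT n m) := by
  rintro V hV ⟨x, hx⟩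
  obtain ⟨c, -, rfl⟩ := exists_coe_mem_Ico hm 0 x
  obtain ⟨ε, hε, hεV⟩ := Metric.isOpen_iff.1 (hV.preimage (AddCircle.continuous_mk' (m : ℝ))) c hx
  obtain ⟨p, hp, hpI⟩ := exists_nadic_mem_Ioo hn (u := c - min ε (m / 2)) (v := c)
    (by have : 0 < min ε ((m : ℝ) / 2) := by positivity
        linarith)
  obtain ⟨q, hq, hqI⟩ := exists_nadic_mem_Ioo hn (u := c) (v := c + min ε (m / 2))
    (by have : 0 < min ε ((m : ℝ) / 2) := by positivity
        linarith)
  have e1 := min_le_left ε ((m : ℝ) / 2)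
  have e2 := min_le_right ε ((m : ℝ) / 2)
  have hpq : p < q := hpI.2.trans hqI.1
  have hqm : q ≤ p + m := by linarith [hpI.1, hqI.2]
  obtain ⟨g, hg1, hg2⟩ := exists_bump hn hm hp hq hpq hqm
  refine ⟨g, fun x hx => ?_, fun h12 => ?_⟩
  · obtain ⟨t, ht, rfl⟩ := exists_coe_mem_Ico hm q x
    by_cases htp : t ≤ p + m
    · exact hg1 t ⟨ht.1, htp⟩
    · exfalso
      apply hx
      have h1 : t - m ∈ Metric.ball c ε := by
        rw [Metric.mem_ball, Real.dist_eq, abs_lt]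
        constructor <;> linarith [ht.2, hpI.1, hqI.2]
      have h2 : ((t - m : ℝ) : AddCircle (m : ℝ)) ∈ V := hεV h1
      rwa [coe_eq_coe_iff_exists.2 ⟨-1, by push_cast; ring⟩] at h2
  · obtain ⟨t', ht', h⟩ := hg2 c ⟨hpI.2, hqI.1⟩ 12 (by norm_num)
    rw [h12] at h
    have : c = t' := eq_of_coe_eq h (by rw [abs_lt]; constructor <;> linarith [ht'.1, ht'.2, hqI.2])
    exact absurd this ht'.1.ne

variable (n m) in
/-- The subgroup of the elements supported in the arc `[p, q]`, that is, of those that fix the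
complementary arc `[q, p + m]` pointwise. -/
def arcFixing (p q : ℝ) : Subgroup (HigmanThompsonT n m) where
  carrier := {k | ∀ t ∈ Set.Icc q (p + m), k.1 (t : AddCircle (m : ℝ)) = t}
  one_mem' _ _ := rfl
  mul_mem' := by
    intro a b ha hb t ht
    change a.1 (b.1 t) = t
    rw [hb t ht, ha t ht]
  inv_mem' := by
    intro a ha t ht
    exact inv_apply_eq (ha t ht)

variable {p q : ℝ}

/-- Outside the open arc `(p, q)` the circle is covered by `[q, p + m]`. -/
theorem exists_coe_mem_Icc_or (hm : 2 ≤ m) (hqm : q ≤ p + m) (x : AddCircle (m : ℝ)) :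
    (∃ t ∈ Set.Ioo p q, (t : AddCircle (m : ℝ)) = x) ∨
      ∃ t ∈ Set.Icc q (p + m), (t : AddCircle (m : ℝ)) = x := by
  obtain ⟨t, ht, rfl⟩ := exists_coe_mem_Ico hm p x
  by_cases htq : t < q
  · rcases ht.1.eq_or_lt with rfl | hpt
    · exact Or.inr ⟨p + m, ⟨hqm, le_rfl⟩, AddCircle.coe_add_period _ _⟩
    · exact Or.inl ⟨t, ⟨hpt, htq⟩, rfl⟩
  · exact Or.inr ⟨t, ⟨not_lt.1 htq, ht.2.le⟩, rfl⟩

theorem coe_ne_coe_of_mem {s t : ℝ} (hs : s ∈ Set.Ioo p q) (ht : t ∈ Set.Icc q (p + m)) :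
    (s : AddCircle (m : ℝ)) ≠ t := by
  intro h
  have := eq_of_coe_eq h (by rw [abs_lt]; constructor <;> linarith [hs.1, hs.2, ht.1, ht.2])
  linarith [hs.2, ht.1]

theorem exists_mem_Ioo_of_ne (hm : 2 ≤ m) (hqm : q ≤ p + m) {k : HigmanThompsonT n m}
    (hk : k ∈ arcFixing n m p q)
    {x : AddCircle (m : ℝ)} (hx : k.1 x ≠ x) : ∃ t ∈ Set.Ioo p q, (t : AddCircle (m : ℝ)) = x := by
  rcases exists_coe_mem_Icc_or hm hqm x with h | ⟨t, ht, rfl⟩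
  · exact h
  · exact absurd (hk t ht) hx

theorem exists_mem_arcFixing_apply_ne (hn : 2 ≤ n) (hm : 2 ≤ m) (hp : p ∈ nadic n)
    (hq : q ∈ nadic n) (hpq : p < q) (hqm : q ≤ p + m) :
    ∃ g ∈ arcFixing n m p q, ∀ t ∈ Set.Ioo p q, g.1 (t : AddCircle (m : ℝ)) ≠ t := by
  obtain ⟨g, hg1, hg2⟩ := exists_bump hn hm hp hq hpq hqm
  refine ⟨g, hg1, fun t ht h => ?_⟩
  obtain ⟨t', ht', h'⟩ := hg2 t ht 1 one_ne_zero
  rw [pow_one, h] at h'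
  have : t = t' := eq_of_coe_eq h' (by rw [abs_lt]; constructor <;> linarith [ht'.1, ht'.2, ht.1])
  exact absurd this ht'.1.ne

theorem exists_suppSubgroup_eq_arcFixing (hn : 2 ≤ n) (hm : 2 ≤ m) (hp : p ∈ nadic n)
    (hq : q ∈ nadic n) (hpq : p < q) (hqm : q < p + m) :
    ∃ f : HigmanThompsonT n m, suppSubgroup f = arcFixing n m p q := by
  obtain ⟨b, hb, hbne⟩ := exists_mem_arcFixing_apply_ne (m := m) hn hm hp hq hpq hqm.le
  refine ⟨b, ?_⟩
  ext k
  rw [mem_suppSubgroup_iff (locallyMoving_higmanThompsonT hn hm)]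
  constructor
  · intro h
    have hsub : closure (movedSet b.1) ⊆ ((↑) : ℝ → AddCircle (m : ℝ)) '' Set.Icc p q := by
      refine closure_minimal (fun x hx => ?_)
        (isCompact_Icc.image (AddCircle.continuous_mk' (m : ℝ))).isClosed
      obtain ⟨t, ht, rfl⟩ := exists_mem_Ioo_of_ne hm hqm.le hb hx
      exact ⟨t, Set.Ioo_subset_Icc_self ht, rfl⟩
    have hIoo : Set.Ioo q (p + m) ⊆ {t : ℝ | k.1 (t : AddCircle (m : ℝ)) = t} := by
      intro t ht
      refine h _ fun hx => ?_
      obtain ⟨s, hs, hst⟩ := hsub hx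
      have := eq_of_coe_eq hst (by rw [abs_lt]; constructor <;> linarith [hs.1, hs.2, ht.1, ht.2])
      linarith [hs.2, ht.1]
    have hcl : IsClosed {t : ℝ | k.1 (t : AddCircle (m : ℝ)) = t} :=
      isClosed_eq (k.1.continuous.comp (AddCircle.continuous_mk' (m : ℝ)))
        (AddCircle.continuous_mk' (m : ℝ))
    have := closure_minimal hIoo hcl
    rw [closure_Ioo hqm.ne] at this
    exact fun t ht => this ht
  · intro h x hx
    rcases exists_coe_mem_Icc_or hm hqm.le x with ⟨t, ht, rfl⟩ | ⟨t, ht, rfl⟩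
    · exact absurd (subset_closure (hbne t ht)) hx
    · exact h t ht

theorem arcFixing_ne_bot (hn : 2 ≤ n) (hm : 2 ≤ m) (hp : p ∈ nadic n)
    (hq : q ∈ nadic n) (hpq : p < q) (hqm : q < p + m) : arcFixing n m p q ≠ ⊥ := by
  obtain ⟨b, hb, hbne⟩ := exists_mem_arcFixing_apply_ne (m := m) hn hm hp hq hpq hqm.le
  intro h
  rw [h, Subgroup.mem_bot] at hb
  obtain ⟨t, ht⟩ := Set.nonempty_Ioo.2 hpq
  exact hbne t ht (by rw [hb]; rfl)

theorem arcFixing_ne_top (hn : 2 ≤ n) (hm : 2 ≤ m) (hp : p ∈ nadic n)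
    (hq : q ∈ nadic n) (hpq : p < q) (hqm : q < p + m) : arcFixing n m p q ≠ ⊤ := by
  obtain ⟨b, hb, hbne⟩ := exists_mem_arcFixing_apply_ne (m := m) (p := q) (q := p + m) hn hm hq
    (add_mem hp (natCast_mem _ _)) hqm (by linarith)
  intro h
  obtain ⟨t, ht⟩ := Set.nonempty_Ioo.2 hqm
  have hb' : b ∈ arcFixing n m p q := by
    rw [h]
    trivial
  exact hbne t ht (hb' t (Set.Ioo_subset_Icc_self ht))

theorem self_mem_suppSubgroup (hn : 2 ≤ n) (hm : 2 ≤ m) (f : HigmanThompsonT n m) :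
    f ∈ suppSubgroup f := by
  rw [mem_suppSubgroup_iff (locallyMoving_higmanThompsonT hn hm)]
  intro x hx
  by_contra h
  exact hx (subset_closure h)

theorem suppSubgroup_one (hn : 2 ≤ n) (hm : 2 ≤ m) :
    suppSubgroup (1 : HigmanThompsonT n m) = ⊥ := by
  rw [eq_bot_iff]
  intro k hk
  rw [mem_suppSubgroup_iff (locallyMoving_higmanThompsonT hn hm)] at hk
  have : movedSet (1 : HigmanThompsonT n m).1 = ∅ := by
    rw [Set.eq_empty_iff_forall_notMem]
    exact fun x hx => hx rfl
  rw [this, closure_empty] at hk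
  exact Subgroup.mem_bot.2 (Subtype.ext (Homeomorph.ext fun x => hk x id))

/-- The elements supported in an arc act so transitively on its `n`-adic points that the support of
a normal subgroup of the form `suppSubgroup f` fills the arc. -/
theorem isArcSubgroup_arcFixing (hn : 2 ≤ n) (hm : 2 ≤ m) (hp : p ∈ nadic n)
    (hq : q ∈ nadic n) (hpq : p < q) (hqm : q < p + m) : IsArcSubgroup (arcFixing n m p q) := by
  refine ⟨arcFixing_ne_bot hn hm hp hq hpq hqm, arcFixing_ne_top hn hm hp hq hpq hqm, ?_, ?_⟩
  · obtain ⟨f, hf⟩ := exists_suppSubgroup_eq_arcFixing hn hm hp hq hpq hqm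
    exact ⟨f, hf.symm⟩
  · intro f hle hne hnorm
    have hcont := AddCircle.continuous_mk' (m : ℝ)
    have hsub : ∀ {U : Set ℝ}, IsOpen U → U.Nonempty → ∃ u v, u < v ∧ Set.Ioo u v ⊆ U := by
      rintro U hU ⟨c, hc⟩
      obtain ⟨ε, hε, h⟩ := Metric.isOpen_iff.1 hU c hc
      refine ⟨c - ε, c + ε, by linarith, ?_⟩
      rwa [← Real.ball_eq_Ioo]
    have hfill : ∀ t ∈ Set.Ioo p q, (t : AddCircle (m : ℝ)) ∈ closure (movedSet f.1) := by
      by_contra! hO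
      obtain ⟨u, v, huv, hO'⟩ := hsub (U := Set.Ioo p q ∩
        {t : ℝ | (t : AddCircle (m : ℝ)) ∈ (closure (movedSet f.1))ᶜ})
        (isOpen_Ioo.inter (isClosed_closure.isOpen_compl.preimage hcont))
        (by obtain ⟨t, h1, h2⟩ := hO
            exact ⟨t, h1, h2⟩)
      obtain ⟨u', v', huv', hM⟩ := hsub (U := Set.Ioo p q ∩
        {t : ℝ | (t : AddCircle (m : ℝ)) ∈ movedSet f.1})
        (isOpen_Ioo.inter ((isOpen_movedSet f.1).preimage hcont)) (by
          have hf1 : f ≠ 1 := by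
            rintro rfl
            exact hne (suppSubgroup_one hn hm)
          obtain ⟨x, hx⟩ := exists_ne_of_ne_one hf1
          obtain ⟨t, ht, rfl⟩ :=
            exists_mem_Ioo_of_ne hm hqm.le (hle (self_mem_suppSubgroup hn hm f)) hx
          exact ⟨t, ht, hx⟩)
      obtain ⟨x, hx, hxI⟩ := exists_nadic_mem_Ioo hn huv'
      obtain ⟨y, hy, hyI, hyx⟩ := exists_mem_Ioo_sub_mem hn hx huv
      obtain ⟨g, hg, hgx⟩ := exists_map_nadic hn hm hp hq hx hy hqm (hM hxI).1 (hO' hyI).1 hyx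
      have hconj := hnorm g hg f (self_mem_suppSubgroup hn hm f)
      rw [mem_suppSubgroup_iff (locallyMoving_higmanThompsonT hn hm)] at hconj
      have h1 := hconj y (hO' hyI).2
      rw [← hgx] at h1
      change g.1 (f.1 (g.1.symm (g.1 x))) = g.1 x at h1
      rw [g.1.symm_apply_apply] at h1
      exact (hM hxI).2 (g.1.injective h1)
    refine le_antisymm hle fun k hk => ?_
    rw [mem_suppSubgroup_iff (locallyMoving_higmanThompsonT hn hm)]
    intro x hx
    by_contra hkx
    obtain ⟨t, ht, rfl⟩ := exists_mem_Ioo_of_ne hm hqm.le hk hkx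
    exact hx (hfill t ht)

/-- A nonempty proper support contains an `n`-adic arc whose endpoints are limits of fixed points:
the endpoints of a maximal arc in the closure of the support. Neither of them can have a
neighbourhood on which the element is affine, so they are breakpoints. -/
theorem exists_arc_of_support (hn : 2 ≤ n) (hm : 2 ≤ m) {f : HigmanThompsonT n m}
    {S : Set ℝ} (hS : S = closure {t : ℝ | f.1 (t : AddCircle (m : ℝ)) ≠ t})
    (hne : S.Nonempty) (huniv : S ≠ Set.univ) :
    ∃ p ∈ nadic n, ∃ q ∈ nadic n, p < q ∧ q < p + m ∧ Set.Icc p q ⊆ S ∧ p ∈ closure Sᶜ ∧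
      q ∈ closure Sᶜ := by
  obtain ⟨a, ha⟩ := (Set.ne_univ_iff_exists_notMem S).1 huniv
  have hfa : f.1 (a : AddCircle (m : ℝ)) = a := by
    by_contra h
    exact ha (by rw [hS]; exact subset_closure h)
  obtain ⟨F, hF, hFa⟩ := exists_isLift f.1 hfa
  have hiff := hF.apply_eq_iff hn hm hFa
  have hSF : S = closure {t : ℝ | F t ≠ t} := by
    rw [hS]
    congr 1
    ext t
    exact not_congr (hiff t)
  have hScl : IsClosed S := by
    rw [hSF]
    exact isClosed_closure
  have hfix : ∀ t, t ∉ S → F t = t := by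
    intro t ht
    by_contra h
    exact ht (by rw [hSF]; exact subset_closure h)
  have hfixcl : closure Sᶜ ⊆ {t | F t = t} :=
    closure_minimal hfix (isClosed_eq hF.cont continuous_id)
  have hnotS : ∀ t, (∀ᶠ s in 𝓝 0, F (t + s) = t + s) → t ∉ S := by
    intro t ht hS'
    rw [hSF, mem_closure_iff_frequently] at hS'
    apply hS'
    have hc : Tendsto (fun u : ℝ => u - t) (𝓝 t) (𝓝 0) := by
      have : Continuous fun u : ℝ => u - t := by fun_prop
      simpa using this.tendsto t
    filter_upwards [hc.eventually ht] with u hu h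
    apply h
    simpa using hu
  have hper : ∀ t : ℝ, t + m ∈ S → t ∈ S := by
    intro t ht
    have hsub : {t : ℝ | F t ≠ t} ⊆ (fun t => t - (m : ℝ)) ⁻¹' S := by
      intro u hu
      rw [hSF]
      refine subset_closure fun h => hu ?_
      have := hF.add_period hn hm (u - m)
      rw [sub_add_cancel, h] at this
      linarith
    rw [hSF] at ht
    simpa using closure_minimal hsub (hScl.preimage (by fun_prop)) ht
  have ham : a + m ∉ S := fun h => ha (hper a h)
  obtain ⟨s, hs, hsa⟩ : ∃ s ∈ S, s ∈ Set.Icc a (a + m) := by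
    obtain ⟨u, hu⟩ : {t : ℝ | f.1 (t : AddCircle (m : ℝ)) ≠ t}.Nonempty := by
      rw [hS] at hne
      exact closure_nonempty_iff.1 hne
    obtain ⟨s, hs, hsu⟩ := exists_coe_mem_Ico hm a (u : AddCircle (m : ℝ))
    refine ⟨s, ?_, Set.Ico_subset_Icc_self hs⟩
    rw [hS]
    refine subset_closure ?_
    change f.1 (s : AddCircle (m : ℝ)) ≠ s
    rw [hsu]
    exact hu
  obtain ⟨p, hpdef⟩ : ∃ p, p = sInf (S ∩ Set.Ici a) := ⟨_, rfl⟩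
  have hbdd : BddBelow (S ∩ Set.Ici a) := ⟨a, fun t ht => ht.2⟩
  have hpS : p ∈ S ∩ Set.Ici a := by
    rw [hpdef]
    exact (hScl.inter isClosed_Ici).csInf_mem ⟨s, hs, hsa.1⟩ hbdd
  have hap : a < p := lt_of_le_of_ne hpS.2 fun h => ha (h ▸ hpS.1)
  have hleft : ∀ t ∈ Set.Ico a p, t ∉ S := by
    intro t ht hS'
    have : p ≤ t := by
      rw [hpdef]
      exact csInf_le hbdd ⟨hS', ht.1⟩
    linarith [ht.2]
  have hpam : p < a + m := by
    have h1 : p ≤ s := by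
      rw [hpdef]
      exact csInf_le hbdd ⟨hs, hsa.1⟩
    exact lt_of_le_of_ne (h1.trans hsa.2) fun h => ham (h ▸ hpS.1)
  have hpcl : p ∈ closure Sᶜ := by
    have h1 : p ∈ closure (Set.Ico a p) := by
      rw [closure_Ico hap.ne]
      exact ⟨hap.le, le_rfl⟩
    exact closure_mono (fun t ht => hleft t ht) h1
  have hFp : F p = p := hfixcl hpcl
  have hslope_one : ∀ {k : ℤ} {s : ℝ}, s ≠ 0 → (n : ℝ) ^ k * s = s → (n : ℝ) ^ k = 1 := by
    intro k s hs h
    exact mul_right_cancel₀ hs (by rw [h, one_mul])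
  obtain ⟨k, ε, hε, hk⟩ := hF.affine_right hm p
  -- `F` is the identity to the left of `p`, so it cannot also be the identity to the right of it.
  have hslope : (n : ℝ) ^ k ≠ 1 := by
    intro h1
    refine hnotS p ?_ hpS.1
    have hev : ∀ᶠ s : ℝ in 𝓝 0, s ∈ Set.Ioo (a - p) ε :=
      Ioo_mem_nhds (by linarith) hε
    filter_upwards [hev] with s hs
    rcases lt_or_ge s 0 with h | h
    · exact hfix _ (hleft _ ⟨by linarith [hs.1], by linarith⟩)
    · rw [hk s ⟨h, hs.2.le⟩, h1, hFp, one_mul]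
  have hpn : p ∈ nadic n := by
    by_contra hp
    obtain ⟨l, hl⟩ := hF.affine_of_notMem hn hm hp
    have hev : ∀ᶠ s : ℝ in 𝓝[<] 0, s ∈ Set.Ioo (a - p) 0 := Ioo_mem_nhdsLT (by linarith)
    obtain ⟨s, hs1, hs2⟩ := (hev.and (hl.filter_mono nhdsWithin_le_nhds)).exists
    rw [hfix _ (hleft (p + s) ⟨by linarith [hs1.1], by linarith [hs1.2]⟩), hFp] at hs2
    have h1 := hslope_one hs1.2.ne (by linarith)
    refine hnotS p ?_ hpS.1
    filter_upwards [hl] with s hs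
    rw [hs, h1, hFp, one_mul]
  obtain ⟨q, hqdef⟩ : ∃ q, q = sInf (Sᶜ ∩ Set.Ici p) := ⟨_, rfl⟩
  have hbdd' : BddBelow (Sᶜ ∩ Set.Ici p) := ⟨p, fun t ht => ht.2⟩
  have hne' : (Sᶜ ∩ Set.Ici p).Nonempty := ⟨a + m, ham, hpam.le⟩
  have hmid : ∀ t ∈ Set.Ico p q, t ∈ S := by
    intro t ht
    by_contra hS'
    have : q ≤ t := by
      rw [hqdef]
      exact csInf_le hbdd' ⟨hS', ht.1⟩
    linarith [ht.2]
  have hpq : p < q := by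
    have : p + ε ≤ q := by
      rw [hqdef]
      refine le_csInf hne' fun t ht => ?_
      by_contra! htε
      have htp : t ≠ p := by
        rintro rfl
        exact ht.1 hpS.1
      have h1 : 0 < t - p := sub_pos.2 (lt_of_le_of_ne ht.2 htp.symm)
      have h2 := hk (t - p) ⟨h1.le, by linarith⟩
      rw [add_sub_cancel, hfix t ht.1, hFp] at h2
      exact hslope (hslope_one h1.ne' (by linarith))
    linarith
  have hIcc : Set.Icc p q ⊆ S := by
    rw [← closure_Ico hpq.ne]
    exact closure_minimal hmid hScl
  have hqS : q ∈ S := hIcc ⟨hpq.le, le_rfl⟩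
  have hqam : q < a + m := by
    have h1 : q ≤ a + m := by
      rw [hqdef]
      exact csInf_le hbdd' ⟨ham, hpam.le⟩
    exact lt_of_le_of_ne h1 fun h => ham (h ▸ hqS)
  have hqcl : q ∈ closure Sᶜ := by
    have h1 : q ∈ closure (Sᶜ ∩ Set.Ici p) := by
      rw [hqdef]
      exact csInf_mem_closure hne' hbdd'
    exact closure_mono Set.inter_subset_left h1
  have hFq : F q = q := hfixcl hqcl
  have hqn : q ∈ nadic n := by
    by_contra hq
    obtain ⟨l, hl⟩ := hF.affine_of_notMem hn hm hq
    obtain ⟨δ, hδ, hlδ⟩ := Metric.eventually_nhds_iff.1 hl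
    obtain ⟨t, ht, htq⟩ := exists_lt_of_csInf_lt hne' (show sInf (Sᶜ ∩ Set.Ici p) < q + δ by
      rw [← hqdef]
      linarith)
    have hqt : q < t := by
      refine lt_of_le_of_ne ?_ fun h => ht.1 (h ▸ hqS)
      rw [hqdef]
      exact csInf_le hbdd' ht
    have h2 := hlδ (y := t - q) (by rw [Real.dist_eq, abs_lt]; constructor <;> linarith)
    rw [add_sub_cancel, hfix t ht.1, hFq] at h2
    have h1 := hslope_one (sub_pos.2 hqt).ne' (by linarith)
    refine hnotS q ?_ hqS
    filter_upwards [hl] with s hs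
    rw [hs, h1, hFq, one_mul]
  exact ⟨p, hpn, q, hqn, hpq, by linarith, hIcc, hpcl, hqcl⟩

theorem exists_eq_arcFixing (hn : 2 ≤ n) (hm : 2 ≤ m) {A : Subgroup (HigmanThompsonT n m)}
    (hA : IsArcSubgroup A) : ∃ p ∈ nadic n, ∃ q ∈ nadic n, p < q ∧ q < p + m ∧
      A = arcFixing n m p q := by
  obtain ⟨hbot, htop, ⟨f, rfl⟩, hmin⟩ := hA
  obtain ⟨S, hS⟩ : ∃ S, S = closure {t : ℝ | f.1 (t : AddCircle (m : ℝ)) ≠ t} := ⟨_, rfl⟩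
  have hS' : S = {t : ℝ | (t : AddCircle (m : ℝ)) ∈ closure (movedSet f.1)} := by
    rw [hS]
    exact (QuotientAddGroup.isOpenMap_coe.preimage_closure_eq_closure_preimage
      (AddCircle.continuous_mk' (m : ℝ)) (movedSet f.1)).symm
  have hmem : ∀ k, k ∈ suppSubgroup f ↔ ∀ t, t ∉ S → k.1 (t : AddCircle (m : ℝ)) = t := by
    intro k
    rw [mem_suppSubgroup_iff (locallyMoving_higmanThompsonT hn hm), hS']
    constructor
    · exact fun h t ht => h _ ht
    · intro h x hx
      obtain ⟨t, -, rfl⟩ := exists_coe_mem_Ico hm 0 x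
      exact h t hx
  obtain ⟨p, hp, q, hq, hpq, hqm, hsub, hpcl, hqcl⟩ := exists_arc_of_support hn hm hS (by
      rw [hS, closure_nonempty_iff]
      have hf1 : f ≠ 1 := by
        rintro rfl
        exact hbot (suppSubgroup_one hn hm)
      obtain ⟨x, hx⟩ := exists_ne_of_ne_one hf1
      obtain ⟨t, -, rfl⟩ := exists_coe_mem_Ico hm 0 x
      exact ⟨t, hx⟩) (by
      rintro h
      refine htop ((Subgroup.eq_top_iff' _).2 fun k => (hmem k).2 fun t ht => ?_)
      exact absurd (h ▸ Set.mem_univ t) ht)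
  refine ⟨p, hp, q, hq, hpq, hqm, ?_⟩
  obtain ⟨b, hb⟩ := exists_suppSubgroup_eq_arcFixing hn hm hp hq hpq hqm
  have hfin := hmin b
  rw [hb] at hfin
  refine (hfin ?_ (arcFixing_ne_bot hn hm hp hq hpq hqm) ?_).symm
  · intro k hk
    rw [hmem]
    intro t ht
    by_contra hkt
    obtain ⟨s, hs, hst⟩ := exists_mem_Ioo_of_ne hm hqm.le hk hkt
    have h1 := hsub (Set.Ioo_subset_Icc_self hs)
    rw [hS'] at ht h1
    change (s : AddCircle (m : ℝ)) ∈ closure (movedSet f.1) at h1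
    rw [hst] at h1
    exact ht h1
  · intro a ha k hk t ht
    have hfixcl : closure Sᶜ ⊆ {t : ℝ | (a⁻¹).1 (t : AddCircle (m : ℝ)) = t} :=
      closure_minimal (fun t ht => (hmem _).1 (inv_mem ha) t ht)
        (isClosed_eq ((a⁻¹).1.continuous.comp (AddCircle.continuous_mk' (m : ℝ)))
          (AddCircle.continuous_mk' (m : ℝ)))
    obtain ⟨F, hF, hFp⟩ := exists_isLift (a⁻¹).1 (hfixcl hpcl)
    have hFq : F q = q := (hF.apply_eq_iff hn hm hFp q).1 (hfixcl hqcl)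
    have hFm : F (p + m) = p + m := by rw [hF.add_period hn hm, hFp]
    have hmono := (hF.strictMono hn hm).monotone
    have h1 : F t ∈ Set.Icc q (p + m) := by
      refine ⟨?_, ?_⟩
      · rw [← hFq]
        exact hmono ht.1
      · rw [← hFm]
        exact hmono ht.2
    change a.1 (k.1 ((a⁻¹).1 t)) = t
    rw [← hF.coe_apply, hk _ h1, hF.coe_apply]
    exact a.1.apply_symm_apply _

theorem mem_map_conj_iff {G : Type*} [Group G] {A : Subgroup G} {g x : G} :
    x ∈ A.map (MulAut.conj g).toMonoidHom ↔ g⁻¹ * x * g ∈ A := by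
  constructor
  · rintro ⟨y, hy, rfl⟩
    have : g⁻¹ * (MulAut.conj g).toMonoidHom y * g = y := by
      simp [mul_assoc]
    rwa [this]
  · exact fun h => ⟨_, h, by simp [mul_assoc]⟩

theorem exists_map_conj_arcFixing {p' q' : ℝ} (hn : 2 ≤ n) (hm : 2 ≤ m) (hp : p ∈ nadic n)
    (hq : q ∈ nadic n) (hp' : p' ∈ nadic n) (hq' : q' ∈ nadic n) (hpq : p < q) (hqm : q < p + m)
    (hpq' : p' < q') (hqm' : q' < p' + m) (h : (q' - p') - (q - p) ∈ nadicIdeal n) :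
    ∃ g : HigmanThompsonT n m,
      (arcFixing n m p q).map (MulAut.conj g).toMonoidHom = arcFixing n m p' q' := by
  obtain ⟨g, hg1, hg2⟩ := exists_map_arc hn hm hp hq hp' hq' hpq hqm hpq' hqm' h
  refine ⟨g, ?_⟩
  ext k
  rw [mem_map_conj_iff]
  constructor
  · intro hk t' ht'
    obtain ⟨t, ht, htt'⟩ := hg2 t' ht'
    have h1 : g.1.symm (k.1 (g.1 t)) = t := hk t ht
    rw [← htt']
    exact (g.1.symm_apply_eq).1 h1
  · intro hk t ht
    obtain ⟨t', ht', htt'⟩ := hg1 t ht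
    change g.1.symm (k.1 (g.1 t)) = t
    rw [htt', hk t' ht', ← htt']
    exact g.1.symm_apply_apply _

/-- Conjugate arc subgroups belong to arcs that are exchanged by an element of the group, hence have
congruent lengths. -/
theorem sub_mem_of_map_conj_eq {p' q' : ℝ} (hn : 2 ≤ n) (hm : 2 ≤ m) (hp : p ∈ nadic n)
    (hq : q ∈ nadic n) (hp' : p' ∈ nadic n) (hq' : q' ∈ nadic n) (hpq : p < q) (hqm : q < p + m)
    (hpq' : p' < q') (hqm' : q' < p' + m) {g : HigmanThompsonT n m}
    (hg : (arcFixing n m p q).map (MulAut.conj g).toMonoidHom = arcFixing n m p' q') :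
    (q' - p') - (q - p) ∈ nadicIdeal n := by
  obtain ⟨b, hb, hbne⟩ := exists_mem_arcFixing_apply_ne (m := m) hn hm hp hq hpq hqm.le
  obtain ⟨b', hb', hbne'⟩ := exists_mem_arcFixing_apply_ne (m := m) hn hm hp' hq' hpq' hqm'.le
  have hto : ∀ t ∈ Set.Ioo p q, ∃ t' ∈ Set.Ioo p' q', (t' : AddCircle (m : ℝ)) = g.1 t := by
    intro t ht
    have h1 : MulAut.conj g b ∈ arcFixing n m p' q' := by
      rw [← hg]
      exact ⟨b, hb, rfl⟩
    refine exists_mem_Ioo_of_ne hm hqm'.le h1 fun h2 => hbne t ht ?_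
    change g.1 (b.1 (g.1.symm (g.1 t))) = g.1 t at h2
    rw [g.1.symm_apply_apply] at h2
    exact g.1.injective h2
  have hfrom : ∀ t' ∈ Set.Ioo p' q', ∃ t ∈ Set.Ioo p q, g.1 t = (t' : AddCircle (m : ℝ)) := by
    intro t' ht'
    rw [← hg, mem_map_conj_iff] at hb'
    obtain ⟨t, ht, htt'⟩ := exists_mem_Ioo_of_ne hm hqm.le hb' (x := g.1.symm t') fun h2 => by
      change g.1.symm (b'.1 (g.1 (g.1.symm t'))) = g.1.symm t' at h2
      rw [g.1.apply_symm_apply] at h2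
      exact hbne' t' ht' (g.1.symm.injective h2)
    refine ⟨t, ht, ?_⟩
    rw [htt', g.1.apply_symm_apply]
  obtain ⟨c, hc⟩ := Set.nonempty_Ioo.2 hpq
  obtain ⟨c', hc', hcc'⟩ := hto c hc
  obtain ⟨F, hF, hFc⟩ := exists_isLift g.1 hcc'.symm
  have hmono := hF.strictMono hn hm
  have hmaps : ∀ t ∈ Set.Ioo p q, F t ∈ Set.Ioo p' q' := by
    intro t ht
    have havoid : ∀ u ∈ Set.Ioo p q, ∀ v ∈ Set.Icc q' (p' + m), F u ≠ v := by
      intro u hu v hv h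
      obtain ⟨w, hw, hwu⟩ := hto u hu
      rw [← hF.coe_apply, h] at hwu
      exact coe_ne_coe_of_mem hw hv hwu
    have havoid' : ∀ u ∈ Set.Ioo p q, F u ≠ p' := by
      intro u hu h
      obtain ⟨w, hw, hwu⟩ := hto u hu
      rw [← hF.coe_apply, h, ← AddCircle.coe_add_period (m : ℝ) p'] at hwu
      exact coe_ne_coe_of_mem hw ⟨hqm'.le, le_rfl⟩ hwu
    constructor
    · by_contra! hle
      have htc : t ≤ c := by
        by_contra! h
        linarith [hmono h, hc'.1]
      obtain ⟨u, hu, hFu⟩ := intermediate_value_Icc htc hF.cont.continuousOn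
        (show p' ∈ Set.Icc (F t) (F c) from ⟨hle, by rw [hFc]; exact hc'.1.le⟩)
      exact havoid' u ⟨ht.1.trans_le hu.1, hu.2.trans_lt hc.2⟩ hFu
    · by_contra! hle
      have htc : c ≤ t := by
        by_contra! h
        linarith [hmono h, hc'.2]
      obtain ⟨u, hu, hFu⟩ := intermediate_value_Icc htc hF.cont.continuousOn
        (show q' ∈ Set.Icc (F c) (F t) from ⟨by rw [hFc]; exact hc'.2.le, hle⟩)
      exact havoid u ⟨hc.1.trans_le hu.1, hu.2.trans_lt ht.2⟩ q' ⟨le_rfl, hqm'.le⟩ hFu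
  have hIcc : ∀ t ∈ Set.Icc p q, F t ∈ Set.Icc p' q' := by
    have h1 : Set.Ioo p q ⊆ F ⁻¹' Set.Icc p' q' := fun t ht => Set.Ioo_subset_Icc_self (hmaps t ht)
    have h2 := closure_minimal h1 (isClosed_Icc.preimage hF.cont)
    rw [closure_Ioo hpq.ne] at h2
    exact h2
  have honto : ∀ v ∈ Set.Ioo p' q', v ∈ Set.Ioo (F p) (F q) := by
    intro v hv
    obtain ⟨t, ht, htv⟩ := hfrom v hv
    rw [← hF.coe_apply] at htv
    have h1 := hmaps t ht
    have h2 : F t = v := eq_of_coe_eq htv (by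
      rw [abs_lt]
      constructor <;> linarith [h1.1, h1.2, hv.1, hv.2])
    rw [← h2]
    exact ⟨hmono ht.1, hmono ht.2⟩
  have hFp := hIcc p ⟨le_rfl, hpq.le⟩
  have hFq := hIcc q ⟨hpq.le, le_rfl⟩
  have hFpq := hmono hpq
  have ep : F p = p' := by
    by_contra h
    have h1 : p' < F p := lt_of_le_of_ne hFp.1 (Ne.symm h)
    obtain ⟨v, hv⟩ := exists_between h1
    linarith [(honto v ⟨hv.1, by linarith [hv.2, hFq.2]⟩).1, hv.2]
  have eq' : F q = q' := by
    by_contra h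
    have h1 : F q < q' := lt_of_le_of_ne hFq.2 h
    obtain ⟨v, hv⟩ := exists_between h1
    linarith [(honto v ⟨by linarith [hv.1, hFp.1], hv.2⟩).2, hv.1]
  have := (hF.lt_and_sub_mem hn hm hpq).2 hp hq
  rwa [ep, eq'] at this

/-- The conjugacy classes of arc subgroups of `HigmanThompsonT n m` correspond to the residue
classes modulo `n - 1`, by the length of the arc; the arcs `[0, (i + 1) / n]` with
`0 ≤ i < n - 1` represent them. -/
theorem card_quot_arcConj (hn : 2 ≤ n) (hm : 2 ≤ m) :
    Nat.card (Quot (ArcConj (HigmanThompsonT n m))) = n - 1 := by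
  have h0 : (0 : ℝ) < n := by exact_mod_cast (show 0 < n by omega)
  have hm2 : (2 : ℝ) ≤ m := by exact_mod_cast hm
  have hmem : ∀ i : Fin (n - 1), ((i : ℕ) + 1 : ℝ) / n ∈ nadic n := fun i => by
    rw [div_eq_mul_inv]
    exact mul_mem (add_mem (natCast_mem _ _) (one_mem _)) (inv_mem_nadic n)
  have hpos : ∀ i : Fin (n - 1), (0 : ℝ) < ((i : ℕ) + 1 : ℝ) / n := fun i => by positivity
  have hlt : ∀ i : Fin (n - 1), ((i : ℕ) + 1 : ℝ) / n < 0 + m := fun i => by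
    have h1 : ((i : ℕ) + 1 : ℝ) / n ≤ 1 := by
      rw [div_le_one h0]
      have : (i : ℕ) + 1 ≤ n := by omega
      exact_mod_cast this
    linarith
  have hcong : ∀ i : Fin (n - 1), ((i : ℕ) + 1 : ℝ) / n - ((i : ℕ) + 1 : ℝ) ∈ nadicIdeal n := by
    intro i
    have := zpow_mul_sub_mem hn (-1) (add_mem (natCast_mem (nadic n) i) (one_mem _))
    rwa [zpow_neg, zpow_one, ← div_eq_inv_mul] at this
  let A : Fin (n - 1) → {A : Subgroup (HigmanThompsonT n m) // IsArcSubgroup A} := fun i =>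
    ⟨arcFixing n m 0 (((i : ℕ) + 1 : ℝ) / n),
      isArcSubgroup_arcFixing hn hm (zero_mem _) (hmem i) (hpos i) (hlt i)⟩
  have hequiv : Equivalence (ArcConj (HigmanThompsonT n m)) := by
    refine ⟨fun A => ⟨1, ?_⟩, ?_, ?_⟩
    · ext x
      rw [mem_map_conj_iff]
      simp
    · rintro ⟨A, hA⟩ ⟨B, hB⟩ ⟨g, hg⟩
      refine ⟨g⁻¹, ?_⟩
      simp only at hg ⊢
      ext x
      rw [mem_map_conj_iff, ← hg, mem_map_conj_iff]
      simp [mul_assoc]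
    · rintro ⟨A, hA⟩ ⟨B, hB⟩ ⟨C, hC⟩ ⟨g, hg⟩ ⟨k, hk⟩
      refine ⟨k * g, ?_⟩
      simp only at hg hk ⊢
      ext x
      rw [mem_map_conj_iff, ← hk, mem_map_conj_iff, ← hg, mem_map_conj_iff]
      simp [mul_assoc]
  have hbij : Function.Bijective fun i => Quot.mk (ArcConj (HigmanThompsonT n m)) (A i) := by
    constructor
    · intro i j hij
      obtain ⟨g, hg⟩ := (hequiv.quot_mk_eq_iff _ _).1 hij
      have h1 := sub_mem_of_map_conj_eq hn hm (zero_mem _) (hmem i) (zero_mem _) (hmem j) (hpos i)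
        (hlt i) (hpos j) (hlt j) hg
      have h2 : (((j : ℕ) - (i : ℕ) : ℤ) : ℝ) ∈ nadicIdeal n := by
        convert add_mem (sub_mem h1 (hcong j)) (hcong i) using 1
        push_cast
        ring
      obtain ⟨c, hc⟩ := dvd_of_intCast_mem_nadicIdeal hn h2
      have hi := i.2
      have hj := j.2
      have h3 := Int.eq_zero_of_abs_lt_dvd ⟨c, hc⟩ (by rw [abs_lt]; constructor <;> omega)
      exact Fin.ext (by omega)
    · rintro ⟨B, hB⟩
      obtain ⟨p, hp, q, hq, hpq, hqm, rfl⟩ := exists_eq_arcFixing hn hm hB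
      obtain ⟨a, ha⟩ := exists_int_sub_mem hn (sub_mem hq hp)
      have hn1 : (0 : ℤ) < n - 1 := by omega
      have hmod := Int.emod_nonneg (a - 1) hn1.ne'
      have hmod' := Int.emod_lt_of_pos (a - 1) hn1
      refine ⟨⟨((a - 1) % ((n : ℤ) - 1)).toNat, by omega⟩, Quot.sound ?_⟩
      refine exists_map_conj_arcFixing hn hm (zero_mem _) (hmem _) hp hq (hpos _) (hlt _) hpq hqm ?_
      have h1 := hcong ⟨((a - 1) % ((n : ℤ) - 1)).toNat, by omega⟩
      have h2 : (a : ℝ) - ((((a - 1) % ((n : ℤ) - 1)).toNat : ℝ) + 1) ∈ nadicIdeal n := by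
        refine mem_nadicIdeal_iff.2 ⟨((a - 1) / ((n : ℤ) - 1) : ℤ), intCast_mem _ _, ?_⟩
        have h3 : ((((a - 1) % ((n : ℤ) - 1)).toNat : ℤ)) = (a - 1) % ((n : ℤ) - 1) :=
          Int.toNat_of_nonneg hmod
        have h4 := Int.mul_ediv_add_emod (a - 1) ((n : ℤ) - 1)
        rw [← h3] at h4
        have h5 : ((n : ℝ) - 1) * (((a - 1) / ((n : ℤ) - 1) : ℤ) : ℝ) +
            (((a - 1) % ((n : ℤ) - 1)).toNat : ℝ) = a - 1 := by exact_mod_cast h4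
        linarith
      convert sub_mem (add_mem ha h2) h1 using 1
      ring
  rw [← Nat.card_congr (Equiv.ofBijective _ hbij), Nat.card_eq_fintype_card, Fintype.card_fin]

end Arc

theorem proposition5 (n m r s : ℕ) (hn : 2 ≤ n) (hm : 2 ≤ m) (hr : 2 ≤ r) (hs : 2 ≤ s)
    (hiso : Nonempty (HigmanThompsonT n m ≃* HigmanThompsonT r s)) : n = r := by
  obtain ⟨φ⟩ := hiso
  have h := card_quot_arcConj_eq φ
  rw [card_quot_arcConj hn hm, card_quot_arcConj hr hs] at h
  omega
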